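/- Let $\mathbb{D}\subset\mathbb{C}$ be the open unit disk, $\mathbb{T}$ its boundary circle, and $dA = dx\,dy/\pi$ the normalized area measure on $\mathbb{D}$. Let $\mathcal{H}$ be a Hilbert space of holomorphic functions on $\mathbb{D}$. Consider the properties - **P1**: the polynomials belong to $\mathcal{H}$ and are dense in $\mathcal{H}$; - **P2**: for each $w\in\mathbb{D}$, the evaluation $F\mapsto F(w)$ is continuous on $\mathcal{H}$; - **P3**: the shift $F(z)\mapsto zF(z)$ maps $\mathcal{H}$ into itself and is continuous. For such $\mathcal{H}$, the maximal domain $\Omega_{max}$ is the set of all $w\in\mathbb{C}$ for which the functional $P\mapsto P(w)$ on polynomials extends to a continuous linear functional on $\mathcal{H}$. For a closed set $E\subset\mathbb{T}$ put $$v_E(z)=\exp\left(-\frac{\operatorname{dist}(z/|z|,E)}{1-|z|}\right),\qquad z\in\mathbb{D}\setminus\{0\},$$ with the convention $\operatorname{dist}(\cdot,\emptyset)=2$. An admissible weight is a function $v\in L^1(\mathbb{D},dA)$ such that for every $0<r<1$ there is $\delta_r>0$ with $v>\delta_r$ a.e. on $r\mathbb{D}$, and $v(z)\le v(rz)$ for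 a.e. $z\in\mathbb{D}$. For such $v$ let $\mathcal{H}_{v,2}$ be the space of holomorphic $F$ on $\mathbb{D}$ with $$\|F\|_{v,2}^2=\sum_{k=0}^{2}\int_{\mathbb{D}}|F^{(k)}|^2\,v\,dA<\infty .$$ **Theorem.** Suppose $\Gamma\subset\mathbb{T}$ is both an $F_\sigma$ set (a countable union of closed sets) and a $G_\delta$ set (a countable intersection of open sets). Then there exists a Hilbert space $\mathcal{H}$ of holomorphic functions on $\mathbb{D}$ satisfying P1–P3 such that $\Omega_{max}=\mathbb{D}\cup\Gamma$. Moreover, there are closed sets $\Gamma_k$, $k = 0, 1, 2, \dots$, with $\bigcup_k\Gamma_k=\Gamma$ and numbers $a_k>0$ with $\sum_k a_k<\infty$ such that $v=\sum_k a_k v_{\Gamma_k}$ is an admissible weight and $\mathcal{H}$ can be taken to be $\mathcal{H}_{v,2}$ with the norm $\|\cdot\|_{v,2}$. -/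

import Mathlib

open MeasureTheory Polynomial

/-- The open unit disk in `ℂ`. -/
abbrev disk : Set ℂ := Metric.ball 0 1

/-- A countable union of closed sets. -/
def IsFSigma (A : Set ℂ) : Prop :=
  ∃ C : ℕ → Set ℂ, (∀ k, IsClosed (C k)) ∧ ⋃ k, C k = A

/-- The space of holomorphic functions on `Ω` (used for open `Ω`). A function on `Ω` is
represented by its extension by `0` to the whole plane, so that two elements are equal exactly
when they agree on `Ω`. -/
def Hol (Ω : Set ℂ) : Submodule ℂ (ℂ → ℂ) where
  carrier := {F | DifferentiableOn ℂ F Ω ∧ ∀ z, z ∉ Ω → F z = 0}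
  add_mem' := fun {F G} hF hG =>
    ⟨hF.1.add hG.1, fun z hz => by simp [hF.2 z hz, hG.2 z hz]⟩
  zero_mem' := ⟨differentiableOn_const 0, fun _ _ => rfl⟩
  smul_mem' := fun c F hF => ⟨hF.1.const_smul c, fun z hz => by simp [hF.2 z hz]⟩

open Classical in
/-- A polynomial, as a holomorphic function on `Ω`. -/
noncomputable def polyOn (Ω : Set ℂ) (P : ℂ[X]) : Hol Ω :=
  ⟨fun z => if z ∈ Ω then P.eval z else 0,
    P.differentiable.differentiableOn.congr (fun z hz => by simp [hz]),
    fun z hz => by simp [hz]⟩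

section FunctionSpaces

/- A topological vector space `H` of holomorphic functions on `Ω` is given by a linear map
`ι : H → Hol Ω` (injective whenever it is used), which identifies `H` with a subspace of
`Hol Ω`. -/
variable {Ω : Set ℂ} {H : Type*} [AddCommGroup H] [Module ℂ H] [TopologicalSpace H]

/-- The polynomials belong to the space and are dense in it. -/
def PolynomialsDense (ι : H →ₗ[ℂ] Hol Ω) : Prop :=
  (∀ P : ℂ[X], ∃ f : H, ι f = polyOn Ω P) ∧ Dense {f : H | ∃ P : ℂ[X], ι f = polyOn Ω P}

/-- Evaluation at each point of `Ω` is continuous. -/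
def EvaluationsContinuous (ι : H →ₗ[ℂ] Hol Ω) : Prop :=
  ∀ w ∈ Ω, Continuous fun f : H => (ι f : ℂ → ℂ) w

/-- Multiplication by the coordinate `z` maps the space into itself and is continuous. -/
def ShiftContinuous (ι : H →ₗ[ℂ] Hol Ω) : Prop :=
  ∃ S : H →L[ℂ] H, ∀ (f : H) (z : ℂ), (ι (S f) : ℂ → ℂ) z = z * (ι f : ℂ → ℂ) z

/-- The maximal domain: all `w ∈ ℂ` for which `P ↦ P(w)`, defined on polynomials, extends to
a continuous linear functional on the space. -/
def maximalDomain (ι : H →ₗ[ℂ] Hol Ω) : Set ℂ :=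
  {w | ∃ L : H →L[ℂ] ℂ, ∀ (f : H) (P : ℂ[X]), ι f = polyOn Ω P → L f = P.eval w}

end FunctionSpaces

/-- The normalized area measure `dx dy / π` on the unit disk. -/
noncomputable def diskArea : Measure ℂ :=
  ENNReal.ofReal (Real.pi⁻¹) • (volume.restrict disk)

/-- The admissible weights on the disk: integrable, essentially bounded below by a positive
constant on each smaller disk, and radially decreasing. -/
def IsAdmissibleWeight (v : ℂ → ℝ) : Prop :=
  Integrable v diskArea ∧
  (∀ r : ℝ, 0 < r → r < 1 →
    ∃ δ : ℝ, 0 < δ ∧ ∀ᵐ z ∂diskArea, z ∈ Metric.ball (0 : ℂ) r → δ < v z) ∧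
  (∀ r : ℝ, 0 < r → r < 1 → ∀ᵐ z ∂diskArea, v z ≤ v (r * z))

/-- The squared norm `∑_{k ≤ n} ∫ |F^(k)|² v dA`, with values in `[0, ∞]`. -/
noncomputable def weightedNormSq (v : ℂ → ℝ) (n : ℕ) (F : ℂ → ℂ) : ENNReal :=
  ∑ k ∈ Finset.range (n + 1),
    ∫⁻ z, ENNReal.ofReal (‖iteratedDeriv k F z‖ ^ 2 * v z) ∂diskArea

/-- `ι` realizes `H` as the weighted space `ℋ_{v,n}`, with its norm: the functions of `H` are
exactly those holomorphic functions on the disk for which `weightedNormSq v n` is finite, and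
this is the square of the norm of `H`. -/
def IsWeightedSpace {H : Type*} [NormedAddCommGroup H] [InnerProductSpace ℂ H]
    (v : ℂ → ℝ) (n : ℕ) (ι : H →ₗ[ℂ] Hol disk) : Prop :=
  Function.Injective ι ∧
  Set.range ι = {F : Hol disk | weightedNormSq v n F < ⊤} ∧
  ∀ f : H, ENNReal.ofReal (‖f‖ ^ 2) = weightedNormSq v n (ι f)

/-- The distance from `ζ` to `E`, for `ζ` on the unit circle and `E` a subset of it. Such a
distance is at most `2` when `E` is nonempty, so the minimum only fixes the convention that the
distance to the empty set is `2`. -/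
noncomputable def circleDist (ζ : ℂ) (E : Set ℂ) : ℝ :=
  (min 2 (Metric.infEDist ζ E)).toReal

/-- The weight `exp (- dist(z/|z|, E) / (1 - |z|))` on the disk. -/
noncomputable def circleWeight (E : Set ℂ) (z : ℂ) : ℝ :=
  Real.exp (-(circleDist (z / (‖z‖ : ℂ)) E) / (1 - ‖z‖))

/-! Since `Γ` is Fσ, it is a union of closed sets `K k`; since it is also Gδ, its complement in the
circle is an increasing union of compact sets `D j`. The weight of a closed set `E` is bounded below
in a Stolz angle at each point of `E` and vanishes to infinite order at points of the circle off
`E`. The lower bound survives summation because all terms are positive. The decay survives, to order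
12, if the coefficients are small enough: with `d k` a lower bound for the distance from `D k` to `K
k`, the choice `a k = (1 / 2) ^ k * d k ^ 12` cancels the constant in the decay of the `k`-th weight
at every point of `D k` (`exists_coefficients`).

At a point `w` of `Γ`, the lower bound and the area mean value inequality give `|P''(t w)| ≤ C ‖P‖ /
(1 - t)`. The factor `1 - t` in the integral remainder of Taylor's formula of order two absorbs this
singularity, so `P ↦ P(w)` is bounded (`mem_maximalDomain_of_stolz`). This is why two derivatives
enter the norm.

At a point `w` of the circle outside `Γ`, the polynomials `((1 + conj w * z) / 2) ^ (m + 2)` equal 1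
at `w`. Differentiation costs a factor `(m + 2) ^ 4` in the squared norm, while decay of order 12
gains `(m + 1) ^ (-6)`, so the norms tend to zero (`notMem_maximalDomain_of_decay`). For `|w| > 1`
the powers of `z / w` do the same.

The space is complete because its embedding by jets into a vector-valued `L²` space has closed range
(`isClosed_range_jetToLp`). Polynomials are dense because the dilates `F(r z)` are bounded in norm,
by radial monotonicity of the weight, and converge weakly to `F` as `r → 1` (`polynomialsDense`). -/

/-! ### Mean value inequalities for holomorphic functions. -/

theorem DifferentiableOn.iteratedDeriv_of_isOpen {F : ℂ → ℂ} {U : Set ℂ} (hU : IsOpen U)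
    (hF : DifferentiableOn ℂ F U) (k : ℕ) : DifferentiableOn ℂ (iteratedDeriv k F) U := by
  induction k with
  | zero => simpa using hF
  | succ k ih => rw [iteratedDeriv_succ]; exact ih.deriv hU

/-- The mean value property for `f ^ 2`, as an inequality on a circle. -/
theorem two_pi_mul_enorm_sq_le_lintegral_circle {f : ℂ → ℂ} {c : ℂ} {ρ s : ℝ} (hs : 0 < s)
    (hsρ : s < ρ) (hf : DifferentiableOn ℂ f (Metric.ball c ρ)) :
    ENNReal.ofReal (2 * Real.pi) * ‖f c‖ₑ ^ 2 ≤
      ∫⁻ θ in Set.Ioo (-Real.pi) Real.pi, ‖f (circleMap c s θ)‖ₑ ^ 2 := by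
  have hd : DiffContOnCl ℂ (fun z => f z ^ 2) (Metric.ball c |s|) := by
    rw [abs_of_pos hs]
    refine DifferentiableOn.diffContOnCl ((hf.pow 2).mono ?_)
    rw [closure_ball c hs.ne']
    exact Metric.closedBall_subset_ball hsρ
  have h1 := hd.circleAverage
  -- The angle is moved to `(-π, π)`, the range used by polar coordinates in the area version.
  rw [Real.circleAverage_eq_integral_add (-Real.pi),
    intervalIntegral.integral_comp_add_right (fun θ => f (circleMap c s θ) ^ 2)] at h1
  have h2 : ∫ θ in Set.Ioo (-Real.pi) Real.pi, f (circleMap c s θ) ^ 2 =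
      (2 * Real.pi : ℝ) • f c ^ 2 := by
    rw [← h1, smul_inv_smul₀ (by positivity), ← integral_Ioc_eq_integral_Ioo,
      intervalIntegral.integral_of_le (by linarith [Real.pi_pos])]
    congr 3 <;> ring
  calc ENNReal.ofReal (2 * Real.pi) * ‖f c‖ₑ ^ 2
      = ‖(2 * Real.pi : ℝ) • f c ^ 2‖ₑ := by
        rw [enorm_smul, enorm_pow, Real.enorm_of_nonneg (by positivity)]
    _ ≤ ∫⁻ θ in Set.Ioo (-Real.pi) Real.pi, ‖f (circleMap c s θ) ^ 2‖ₑ := by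
        rw [← h2]; exact enorm_integral_le_lintegral_enorm _
    _ = _ := by simp only [enorm_pow]

/-- The area form of the submean value property of `|f| ^ 2`. -/
theorem pi_mul_enorm_sq_le_lintegral_ball {f : ℂ → ℂ} {c : ℂ} {ρ : ℝ} (hρ : 0 < ρ)
    (hf : DifferentiableOn ℂ f (Metric.ball c ρ)) :
    ENNReal.ofReal (Real.pi * ρ ^ 2) * ‖f c‖ₑ ^ 2 ≤ ∫⁻ z in Metric.ball c ρ, ‖f z‖ₑ ^ 2 := by
  set S : Set (ℝ × ℝ) := Set.Ioo 0 ρ ×ˢ Set.Ioo (-Real.pi) Real.pi with hS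
  have hSm : MeasurableSet S := measurableSet_Ioo.prod measurableSet_Ioo
  set g : ℝ × ℝ → ENNReal := fun p => ENNReal.ofReal p.1 * ‖f (circleMap c p.1 p.2)‖ₑ ^ 2 with hg
  have hmem : ∀ p ∈ S, circleMap c p.1 p.2 ∈ Metric.ball c ρ := fun p hp => by
    simp only [hS, Set.mem_prod, Set.mem_Ioo] at hp
    simp [circleMap, abs_of_pos hp.1.1, hp.1.2]
  have hgm : AEMeasurable g (volume.restrict S) := by
    refine ContinuousOn.aemeasurable ?_ hSm
    have h1 : ContinuousOn (fun p : ℝ × ℝ => f (circleMap c p.1 p.2)) S :=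
      hf.continuousOn.comp (by unfold circleMap; fun_prop) hmem
    have h2 : ContinuousOn (fun p : ℝ × ℝ => ENNReal.ofReal (p.1 * ‖f (circleMap c p.1 p.2)‖ ^ 2))
        S := ENNReal.continuous_ofReal.comp_continuousOn (continuousOn_fst.mul (h1.norm.pow 2))
    refine h2.congr fun p hp => ?_
    simp only [hg]
    rw [ENNReal.ofReal_mul (by simp only [hS, Set.mem_prod, Set.mem_Ioo] at hp; exact hp.1.1.le),
      ENNReal.ofReal_pow (norm_nonneg _), ofReal_norm]
  have hpolar : ∫⁻ p in S, g p ≤ ∫⁻ z in Metric.ball c ρ, ‖f z‖ₑ ^ 2 := by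
    rw [← lintegral_indicator measurableSet_ball, ← lintegral_add_left_eq_self _ c,
      ← Complex.lintegral_comp_polarCoord_symm]
    refine le_trans ?_ (lintegral_mono_set (s := S) ?_)
    · refine setLIntegral_mono_ae' hSm (ae_of_all _ fun p hp => ?_)
      have : c + Complex.polarCoord.symm p = circleMap c p.1 p.2 := by
        simp [circleMap, Complex.exp_mul_I]
      rw [this, Set.indicator_of_mem (hmem p hp)]
      rfl
    · exact Set.prod_mono Set.Ioo_subset_Ioi_self subset_rfl
  refine le_trans ?_ hpolar
  rw [hS, Measure.volume_eq_prod, ← Measure.prod_restrict, lintegral_prod _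
    (by rwa [Measure.prod_restrict, ← Measure.volume_eq_prod])]
  have hs : ∫⁻ s in Set.Ioo 0 ρ, ENNReal.ofReal s * (ENNReal.ofReal (2 * Real.pi) * ‖f c‖ₑ ^ 2) =
      ENNReal.ofReal (Real.pi * ρ ^ 2) * ‖f c‖ₑ ^ 2 := by
    rw [lintegral_mul_const _ ENNReal.measurable_ofReal,
      ← ofReal_integral_eq_lintegral_ofReal, ← integral_Ioc_eq_integral_Ioo,
      ← intervalIntegral.integral_of_le hρ.le, integral_id, ← mul_assoc,
      ← ENNReal.ofReal_mul (by
        simp only [ne_eq, OfNat.ofNat_ne_zero, not_false_eq_true, zero_pow, sub_zero]; positivity)]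
    · congr 2; ring
    · exact (continuous_id.integrableOn_Icc).mono_set Set.Ioo_subset_Icc_self
    · exact (ae_restrict_iff' measurableSet_Ioo).2 (ae_of_all _ fun s hs => hs.1.le)
  rw [← hs]
  refine setLIntegral_mono_ae' measurableSet_Ioo (ae_of_all _ fun s hs => ?_)
  simp only [hg]
  rw [lintegral_const_mul' _ _ ENNReal.ofReal_ne_top]
  gcongr
  exact two_pi_mul_enorm_sq_le_lintegral_circle hs.1 hs.2 hf

/-! ### The area measure on the disk and weighted pointwise bounds. -/

theorem diskArea_eq : diskArea = (ENNReal.ofReal Real.pi⁻¹ • volume).restrict disk := by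
  rw [diskArea, Measure.restrict_smul]

instance : IsFiniteMeasure diskArea := by
  rw [diskArea]
  have : IsFiniteMeasure (volume.restrict disk) := ⟨by simp⟩
  exact Measure.smul_finite _ ENNReal.ofReal_ne_top

theorem ae_diskArea_mem : ∀ᵐ z ∂diskArea, z ∈ disk := by
  rw [diskArea_eq]; exact ae_restrict_mem measurableSet_ball

/-- A holomorphic function is controlled at the centre of a ball by its weighted `L²` norm, when
the weight is bounded below on the ball. -/
theorem enorm_sq_le_of_weight_ge {f : ℂ → ℂ} {v : ℂ → ℝ} {c : ℂ} {ρ δ : ℝ} (hρ : 0 < ρ)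
    (hδ : 0 < δ) (hc : Metric.ball c ρ ⊆ disk) (hf : DifferentiableOn ℂ f disk)
    (hv : ∀ᵐ z ∂diskArea, z ∈ Metric.ball c ρ → δ ≤ v z) :
    ENNReal.ofReal (δ * ρ ^ 2) * ‖f c‖ₑ ^ 2 ≤
      ∫⁻ z, ENNReal.ofReal (‖f z‖ ^ 2 * v z) ∂diskArea := by
  have h1 := pi_mul_enorm_sq_le_lintegral_ball hρ (hf.mono hc)
  have h2 : (diskArea.restrict (Metric.ball c ρ)) =
      ENNReal.ofReal Real.pi⁻¹ • volume.restrict (Metric.ball c ρ) := by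
    rw [diskArea, Measure.restrict_smul, Measure.restrict_restrict measurableSet_ball,
      Set.inter_eq_self_of_subset_left hc]
  calc ENNReal.ofReal (δ * ρ ^ 2) * ‖f c‖ₑ ^ 2
      = ENNReal.ofReal δ * (ENNReal.ofReal Real.pi⁻¹ *
          (ENNReal.ofReal (Real.pi * ρ ^ 2) * ‖f c‖ₑ ^ 2)) := by
        simp only [← mul_assoc]
        rw [← ENNReal.ofReal_mul hδ.le, ← ENNReal.ofReal_mul (by positivity)]
        congr 2
        field_simp
    _ ≤ ENNReal.ofReal δ * (ENNReal.ofReal Real.pi⁻¹ *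
          ∫⁻ z in Metric.ball c ρ, ‖f z‖ₑ ^ 2) := by gcongr
    _ = ∫⁻ z in Metric.ball c ρ, ENNReal.ofReal δ * ‖f z‖ₑ ^ 2 ∂diskArea := by
        rw [h2, lintegral_smul_measure, lintegral_const_mul' _ _ ENNReal.ofReal_ne_top, smul_eq_mul]
        ring
    _ ≤ ∫⁻ z in Metric.ball c ρ, ENNReal.ofReal (‖f z‖ ^ 2 * v z) ∂diskArea := by
        refine setLIntegral_mono_ae' measurableSet_ball ?_
        filter_upwards [hv] with z hz hzc
        rw [← ofReal_norm, ← ENNReal.ofReal_pow (norm_nonneg _), ← ENNReal.ofReal_mul hδ.le]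
        refine ENNReal.ofReal_le_ofReal ?_
        rw [mul_comm]
        gcongr
        exact hz hzc
    _ ≤ _ := setLIntegral_le_lintegral _ _

/-! ### The weighted space as a closed subspace of a vector-valued `L²` space. -/

/-- The derivatives of order at most `n` of a function on the disk, as one vector-valued
function. -/
noncomputable def jet (n : ℕ) : Hol disk →ₗ[ℂ] (ℂ → EuclideanSpace ℂ (Fin (n + 1))) where
  toFun F z := WithLp.toLp 2 fun k => disk.indicator (iteratedDeriv k (F : ℂ → ℂ)) z
  map_add' F G := by
    ext z k
    by_cases hz : z ∈ disk
    · have hd : ∀ F : Hol disk, ContDiffAt ℂ (k : ℕ) (F : ℂ → ℂ) z := fun F =>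
        (F.2.1.contDiffOn Metric.isOpen_ball).contDiffAt (Metric.isOpen_ball.mem_nhds hz)
      simp [Set.indicator_of_mem hz, iteratedDeriv_add (hd F) (hd G)]
    · simp [Set.indicator_of_notMem hz]
  map_smul' c F := by
    ext z k
    by_cases hz : z ∈ disk
    · simp [Set.indicator_of_mem hz]
    · simp [Set.indicator_of_notMem hz]

theorem jet_apply {n : ℕ} {F : Hol disk} {z : ℂ} (hz : z ∈ disk) (k : Fin (n + 1)) :
    jet n F z k = iteratedDeriv k (F : ℂ → ℂ) z := by
  simp [jet, Set.indicator_of_mem hz]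

/-- The measure `v dA` on the disk. -/
noncomputable def weightMeasure (v : ℂ → ℝ) : Measure ℂ :=
  diskArea.withDensity fun z => ENNReal.ofReal (v z)

theorem iteratedDeriv_aemeasurable (F : Hol disk) (k : ℕ) :
    AEMeasurable (iteratedDeriv k (F : ℂ → ℂ)) diskArea := by
  rw [diskArea_eq]
  exact ((F.2.1.iteratedDeriv_of_isOpen Metric.isOpen_ball k).continuousOn).aemeasurable
    measurableSet_ball

theorem jet_aestronglyMeasurable (n : ℕ) (F : Hol disk) (v : ℂ → ℝ) :
    AEStronglyMeasurable (jet n F) (weightMeasure v) := by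
  refine AEStronglyMeasurable.mono_ac (withDensity_absolutelyContinuous _ _) ?_
  have h : AEMeasurable (fun z (k : Fin (n + 1)) => disk.indicator (iteratedDeriv k (F : ℂ → ℂ)) z)
      diskArea := aemeasurable_pi_lambda _ fun k =>
    (iteratedDeriv_aemeasurable F k).indicator measurableSet_ball
  exact ((WithLp.measurable_toLp 2 _).comp_aemeasurable h).aestronglyMeasurable

theorem lintegral_enorm_jet_sq {v : ℂ → ℝ} (hv : AEMeasurable v diskArea) (n : ℕ) (F : Hol disk) :
    ∫⁻ z, ‖jet n F z‖ₑ ^ 2 ∂(weightMeasure v) = weightedNormSq v n F := by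
  have h : ∀ z ∈ disk, ENNReal.ofReal (v z) * ‖jet n F z‖ₑ ^ 2 =
      ∑ k ∈ Finset.range (n + 1), ENNReal.ofReal (‖iteratedDeriv k (F : ℂ → ℂ) z‖ ^ 2 * v z) := by
    intro z hz
    rw [← ofReal_norm, ← ENNReal.ofReal_pow (norm_nonneg _), EuclideanSpace.norm_sq_eq,
      ENNReal.ofReal_sum_of_nonneg fun _ _ => by positivity, Finset.mul_sum,
      Finset.sum_range]
    refine Finset.sum_congr rfl fun k _ => ?_
    rw [jet_apply hz, ENNReal.ofReal_mul (by positivity), mul_comm]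
  have hm : AEMeasurable (fun z => ENNReal.ofReal (v z)) diskArea := hv.ennreal_ofReal
  rw [weightMeasure, lintegral_withDensity_eq_lintegral_mul₀' hm
    ((jet_aestronglyMeasurable n F v).enorm.pow_const 2), weightedNormSq,
    ← lintegral_finsetSum']
  · refine lintegral_congr_ae ?_
    filter_upwards [ae_diskArea_mem] with z hz using h z hz
  · intro k _
    exact (((iteratedDeriv_aemeasurable F k).norm.pow_const 2).mul hv).ennreal_ofReal

theorem eLpNorm_jet_sq {v : ℂ → ℝ} (hv : AEMeasurable v diskArea) (n : ℕ) (F : Hol disk) :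
    eLpNorm (jet n F) 2 (weightMeasure v) ^ 2 = weightedNormSq v n F := by
  rw [← lintegral_enorm_jet_sq hv]
  have := eLpNorm_nnreal_pow_eq_lintegral (f := jet n F) (μ := weightMeasure v)
    (p := 2) two_ne_zero
  simpa using this

theorem memLp_jet_iff {v : ℂ → ℝ} (hv : AEMeasurable v diskArea) (n : ℕ) (F : Hol disk) :
    MemLp (jet n F) 2 (weightMeasure v) ↔ weightedNormSq v n F < ⊤ := by
  rw [← eLpNorm_jet_sq hv, MemLp, and_iff_right (jet_aestronglyMeasurable n F v)]
  simp [lt_top_iff_ne_top]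

/-- The derivatives of order at most `n` are bounded by the weighted norm on smaller disks. -/
theorem exists_mul_norm_sq_le {v : ℂ → ℝ} (hv : IsAdmissibleWeight v) (n : ℕ) {r : ℝ}
    (hr : 0 < r) (hr1 : r < 1) :
    ∃ c : ℝ, 0 < c ∧ ∀ (F : Hol disk) (N : ℝ), weightedNormSq v n F = ENNReal.ofReal (N ^ 2) →
      ∀ k ≤ n, ∀ z ∈ Metric.ball (0 : ℂ) r, c * ‖iteratedDeriv k (F : ℂ → ℂ) z‖ ^ 2 ≤ N ^ 2 := by
  obtain ⟨δ, hδ, h⟩ := hv.2.1 ((1 + r) / 2) (by linarith) (by linarith)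
  refine ⟨δ * ((1 - r) / 2) ^ 2, by have : 0 < 1 - r := by linarith
                                    positivity, fun F N hN k hk z hz => ?_⟩
  have hsub : Metric.ball z ((1 - r) / 2) ⊆ Metric.ball 0 ((1 + r) / 2) := by
    refine Metric.ball_subset_ball' ?_
    rw [mem_ball_zero_iff] at hz
    rw [dist_zero_right]; linarith
  have h1 := enorm_sq_le_of_weight_ge (c := z) (by linarith : 0 < (1 - r) / 2) hδ
    (hsub.trans (Metric.ball_subset_ball (by linarith)))
    (F.2.1.iteratedDeriv_of_isOpen Metric.isOpen_ball k)
    (by filter_upwards [h] with y hy hyc using (hy (hsub hyc)).le)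
  have h2 : ∫⁻ z, ENNReal.ofReal (‖iteratedDeriv k (F : ℂ → ℂ) z‖ ^ 2 * v z) ∂diskArea ≤
      ENNReal.ofReal (N ^ 2) := by
    rw [← hN]
    exact Finset.single_le_sum (f := fun k =>
      ∫⁻ z, ENNReal.ofReal (‖iteratedDeriv k (F : ℂ → ℂ) z‖ ^ 2 * v z) ∂diskArea)
      (fun _ _ => zero_le) (Finset.mem_range.2 (by omega))
  have h3 := h1.trans h2
  rw [← ofReal_norm, ← ENNReal.ofReal_pow (norm_nonneg _), ← ENNReal.ofReal_mul (by positivity)]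
    at h3
  exact (ENNReal.ofReal_le_ofReal_iff (by positivity)).1 h3

/-- The functions with finite weighted norm. -/
noncomputable def weightedSubmodule (v : ℂ → ℝ) (n : ℕ) : Submodule ℂ (Hol disk) where
  carrier := {F | MemLp (jet n F) 2 (weightMeasure v)}
  add_mem' {F G} hF hG := by
    simp only [Set.mem_ofPred_eq, map_add] at *
    exact hF.add hG
  zero_mem' := by simp
  smul_mem' c F hF := by
    simp only [Set.mem_ofPred_eq, map_smul] at *
    exact hF.const_smul c

theorem mem_weightedSubmodule {v : ℂ → ℝ} {n : ℕ} {F : Hol disk} :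
    F ∈ weightedSubmodule v n ↔ MemLp (jet n F) 2 (weightMeasure v) := Iff.rfl

/-- The jet map into the vector-valued `L²` space. -/
noncomputable def jetToLp (v : ℂ → ℝ) (n : ℕ) :
    weightedSubmodule v n →ₗ[ℂ] Lp (EuclideanSpace ℂ (Fin (n + 1))) 2 (weightMeasure v) where
  toFun F := MemLp.toLp (jet n (F : Hol disk)) (mem_weightedSubmodule.1 F.2)
  map_add' F G := by
    rw [← MemLp.toLp_add]
    congr 1
    exact map_add (jet n) _ _
  map_smul' c F := by
    rw [RingHom.id_apply, ← MemLp.toLp_const_smul]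
    congr 1
    exact map_smul (jet n) _ _

theorem weightedNormSq_eq_norm_jetToLp {v : ℂ → ℝ} (hv : AEMeasurable v diskArea) {n : ℕ}
    (F : weightedSubmodule v n) :
    weightedNormSq v n (F : Hol disk) = ENNReal.ofReal (‖jetToLp v n F‖ ^ 2) := by
  rw [← eLpNorm_jet_sq hv, ENNReal.ofReal_pow (norm_nonneg _)]
  congr 1
  rw [jetToLp]
  simp only [LinearMap.coe_mk, AddHom.coe_mk, Lp.norm_toLp]
  rw [ENNReal.ofReal_toReal (mem_weightedSubmodule.1 F.2).2.ne]

/-- An admissible weight is positive almost everywhere, being bounded below on each disk of an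
exhaustion, so a null set for `v dA` is null for `dA`. -/
theorem ae_diskArea_of_ae_weightMeasure {v : ℂ → ℝ} (hv : IsAdmissibleWeight v) {p : ℂ → Prop}
    (h : ∀ᵐ z ∂(weightMeasure v), p z) : ∀ᵐ z ∂diskArea, p z := by
  have hm : AEMeasurable (fun z => ENNReal.ofReal (v z)) diskArea :=
    hv.1.aestronglyMeasurable.aemeasurable.ennreal_ofReal
  have hpos : ∀ᵐ z ∂diskArea, 0 < v z := by
    have : ∀ m : ℕ, ∀ᵐ z ∂diskArea, z ∈ Metric.ball (0 : ℂ) (1 - 1 / (m + 2)) → 0 < v z := by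
      intro m
      have h0 : (1 : ℝ) / (m + 2) < 1 := by
        rw [div_lt_one (by positivity)]; linarith [(Nat.cast_nonneg m : (0 : ℝ) ≤ m)]
      have h1 : (0 : ℝ) < 1 / (m + 2) := by positivity
      obtain ⟨δ, hδ, h⟩ := hv.2.1 (1 - 1 / (m + 2)) (by linarith) (by linarith)
      filter_upwards [h] with z hz hzb using hδ.trans (hz hzb)
    filter_upwards [ae_all_iff.2 this, ae_diskArea_mem] with z hz hzd
    rw [disk, mem_ball_zero_iff] at hzd
    obtain ⟨m, hm⟩ := exists_nat_one_div_lt (sub_pos.2 hzd)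
    refine hz m ?_
    rw [mem_ball_zero_iff]
    have : (1 : ℝ) / (m + 2) ≤ 1 / (m + 1) := by gcongr; norm_num
    linarith
  rw [weightMeasure, ae_withDensity_iff' hm] at h
  filter_upwards [h, hpos] with z hz hz0
  exact hz (by simpa using hz0)

theorem eqOn_of_ae_eq_disk {F G : ℂ → ℂ} (hF : ContinuousOn F disk) (hG : ContinuousOn G disk)
    (h : ∀ᵐ z ∂diskArea, F z = G z) : Set.EqOn F G disk := by
  refine Measure.eqOn_open_of_ae_eq (μ := volume) ?_ Metric.isOpen_ball hF hG
  rw [diskArea, Measure.ae_ennreal_smul_measure_iff] at h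
  · exact h
  · simp [Real.pi_pos]

/-- The zeroth component of the jet already determines the function, by continuity. -/
theorem jetToLp_injective {v : ℂ → ℝ} (hv : IsAdmissibleWeight v) (n : ℕ) :
    Function.Injective (jetToLp v n) := by
  rw [injective_iff_map_eq_zero]
  intro F hF
  have h1 : jet n (F : Hol disk) =ᵐ[weightMeasure v] 0 := by
    have := (MemLp.coeFn_toLp (mem_weightedSubmodule.1 F.2)).symm
    refine this.trans ?_
    change (jetToLp v n F : ℂ → _) =ᵐ[_] 0
    rw [hF]
    exact Lp.coeFn_zero _ _ _
  have h2 := ae_diskArea_of_ae_weightMeasure hv h1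
  have h3 : Set.EqOn ((F : Hol disk) : ℂ → ℂ) 0 disk := by
    refine eqOn_of_ae_eq_disk (F : Hol disk).2.1.continuousOn continuousOn_const ?_
    filter_upwards [h2, ae_diskArea_mem] with z hz hzd
    have := congrArg (fun x => x 0) hz
    simpa [jet_apply hzd] using this
  ext z
  by_cases hz : z ∈ disk
  · simpa using h3 hz
  · simpa using (F : Hol disk).2.2 z hz

open Filter Topology in
theorem TendstoLocallyUniformlyOn.iteratedDeriv {F : ℕ → ℂ → ℂ} {f : ℂ → ℂ} {U : Set ℂ}
    (hU : IsOpen U) (hf : TendstoLocallyUniformlyOn F f atTop U)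
    (hF : ∀ m, DifferentiableOn ℂ (F m) U) (k : ℕ) :
    TendstoLocallyUniformlyOn (fun m => iteratedDeriv k (F m)) (iteratedDeriv k f) atTop U := by
  induction k with
  | zero => simpa using hf
  | succ k ih =>
    simp only [iteratedDeriv_succ]
    exact ih.deriv (Eventually.of_forall fun m => (hF m).iteratedDeriv_of_isOpen hU k) hU

/-- The restriction to the disk of a function that is holomorphic there. -/
noncomputable def Hol.ofDifferentiableOn (f : ℂ → ℂ) (hf : DifferentiableOn ℂ f disk) : Hol disk :=
  ⟨disk.indicator f, hf.congr fun _ hz => Set.indicator_of_mem hz f,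
    fun _ hz => Set.indicator_of_notMem hz f⟩

theorem Hol.eqOn_ofDifferentiableOn {f : ℂ → ℂ} (hf : DifferentiableOn ℂ f disk) :
    Set.EqOn (Hol.ofDifferentiableOn f hf : ℂ → ℂ) f disk :=
  fun _ hz => Set.indicator_of_mem hz f

theorem Hol.ext_disk {F G : Hol disk} (h : Set.EqOn (F : ℂ → ℂ) (G : ℂ → ℂ) disk) : F = G := by
  ext z
  by_cases hz : z ∈ disk
  · exact h hz
  · rw [F.2.2 z hz, G.2.2 z hz]

open Filter Topology in
/-- A sequence of holomorphic functions that is uniformly Cauchy on smaller disks converges. -/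
theorem Hol.exists_tendstoLocallyUniformlyOn {F : ℕ → Hol disk}
    (hF : ∀ r : ℝ, 0 < r → r < 1 →
      UniformCauchySeqOn (fun m => (F m : ℂ → ℂ)) atTop (Metric.ball 0 r)) :
    ∃ G : Hol disk, TendstoLocallyUniformlyOn (fun m => (F m : ℂ → ℂ)) (G : ℂ → ℂ) atTop disk := by
  have hr : ∀ z ∈ disk, ∃ r : ℝ, 0 < r ∧ r < 1 ∧ z ∈ Metric.ball (0 : ℂ) r := fun z hz => by
    rw [disk, mem_ball_zero_iff] at hz
    obtain ⟨r, h1, h2⟩ := exists_between hz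
    exact ⟨r, (norm_nonneg z).trans_lt h1, h2, mem_ball_zero_iff.2 h1⟩
  have hlim : ∀ z ∈ disk, ∃ y, Tendsto (fun m => (F m : ℂ → ℂ) z) atTop (𝓝 y) := fun z hz => by
    obtain ⟨r, h0, h1, hzr⟩ := hr z hz
    exact cauchySeq_tendsto_of_complete ((hF r h0 h1).cauchySeq hzr)
  choose! g hg using hlim
  have hloc : TendstoLocallyUniformlyOn (fun m => (F m : ℂ → ℂ)) g atTop disk := by
    intro u hu z hz
    obtain ⟨r, h0, h1, hzr⟩ := hr z hz
    refine ⟨Metric.ball 0 r, mem_nhdsWithin_of_mem_nhds (Metric.isOpen_ball.mem_nhds hzr), ?_⟩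
    exact (hF r h0 h1).tendstoUniformlyOn_of_tendsto
      (fun y hy => hg y (Metric.ball_subset_ball h1.le hy)) u hu
  have hd : DifferentiableOn ℂ g disk :=
    hloc.differentiableOn (Eventually.of_forall fun m => (F m).2.1) Metric.isOpen_ball
  exact ⟨Hol.ofDifferentiableOn g hd,
    hloc.congr_right (Hol.eqOn_ofDifferentiableOn hd).symm⟩

open Filter Topology in
-- Norm convergence forces locally uniform convergence to a holomorphic `G`, and then all
-- derivatives converge pointwise. A subsequence of the jets converges almost everywhere to the `L²`
-- limit, which is therefore the jet of `G`.
theorem isClosed_range_jetToLp {v : ℂ → ℝ} (hv : IsAdmissibleWeight v) (n : ℕ) :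
    IsClosed (LinearMap.range (jetToLp v n) :
      Set (Lp (EuclideanSpace ℂ (Fin (n + 1))) 2 (weightMeasure v))) := by
  have hvm : AEMeasurable v diskArea := hv.1.aestronglyMeasurable.aemeasurable
  refine IsSeqClosed.isClosed fun x g hx hxg => ?_
  choose F hF using fun m => LinearMap.mem_range.1 (hx m)
  have hcauchy : ∀ r : ℝ, 0 < r → r < 1 →
      UniformCauchySeqOn (fun m => ((F m : Hol disk) : ℂ → ℂ)) atTop (Metric.ball 0 r) := by
    intro r h0 h1
    obtain ⟨c, hc, hcb⟩ := exists_mul_norm_sq_le hv n h0 h1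
    rw [Metric.uniformCauchySeqOn_iff]
    intro ε hε
    obtain ⟨M, hM⟩ := Metric.cauchySeq_iff.1 hxg.cauchySeq (√c * ε) (by positivity)
    refine ⟨M, fun i hi j hj z hz => ?_⟩
    have h2 := hcb ((F i - F j : weightedSubmodule v n) : Hol disk) _
      (weightedNormSq_eq_norm_jetToLp hvm _) 0 n.zero_le z hz
    have h3 := hM i hi j hj
    rw [dist_eq_norm, ← hF, ← hF, ← map_sub] at h3
    have h4 : c * ‖((F i : Hol disk) : ℂ → ℂ) z - ((F j : Hol disk) : ℂ → ℂ) z‖ ^ 2 <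
        (√c * ε) ^ 2 := lt_of_le_of_lt (by simpa using h2) (by gcongr)
    rw [mul_pow, Real.sq_sqrt hc.le] at h4
    rw [dist_eq_norm]
    exact lt_of_pow_lt_pow_left₀ 2 hε.le (lt_of_mul_lt_mul_left h4 hc.le)
  obtain ⟨G, hG⟩ := Hol.exists_tendstoLocallyUniformlyOn hcauchy
  obtain ⟨φ, hφ, hae⟩ := (tendstoInMeasure_of_tendsto_Lp hxg).exists_seq_tendsto_ae
  have hjet : jet n G =ᵐ[weightMeasure v] g := by
    have hcoe : ∀ m, (x m : ℂ → _) =ᵐ[weightMeasure v] jet n (F m : Hol disk) := fun m => by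
      rw [← hF]; exact MemLp.coeFn_toLp (mem_weightedSubmodule.1 (F m).2)
    have hd : ∀ᵐ z ∂(weightMeasure v), z ∈ disk :=
      (withDensity_absolutelyContinuous _ _).ae_le ae_diskArea_mem
    filter_upwards [hae, ae_all_iff.2 hcoe, hd] with z hz hzx hzd
    refine tendsto_nhds_unique ?_ hz
    simp only [hzx]
    refine Tendsto.comp (g := fun m => jet n (F m : Hol disk) z) ?_ hφ.tendsto_atTop
    have : ∀ k : Fin (n + 1), Tendsto (fun m => jet n (F m : Hol disk) z k) atTop
        (𝓝 (jet n G z k)) := fun k => by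
      simp only [jet_apply hzd]
      exact (hG.iteratedDeriv Metric.isOpen_ball (fun m => (F m : Hol disk).2.1) k).tendsto_at hzd
    exact ((PiLp.continuous_toLp 2 _).tendsto _).comp (tendsto_pi_nhds.2 this)
  have hmem : MemLp (jet n G) 2 (weightMeasure v) := (memLp_congr_ae hjet).2 (Lp.memLp g)
  refine ⟨⟨G, hmem⟩, ?_⟩
  exact Lp.ext ((MemLp.coeFn_toLp hmem).trans hjet)

/-- For an admissible weight, the weighted space is a Hilbert space. -/
theorem exists_isWeightedSpace {v : ℂ → ℝ} (hv : IsAdmissibleWeight v) (n : ℕ) :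
    ∃ (H : Type) (_ : NormedAddCommGroup H) (_ : InnerProductSpace ℂ H)
      (_ : CompleteSpace H) (ι : H →ₗ[ℂ] Hol disk), IsWeightedSpace v n ι := by
  have hvm : AEMeasurable v diskArea := hv.1.aestronglyMeasurable.aemeasurable
  let e := LinearEquiv.ofInjective (jetToLp v n) (jetToLp_injective hv n)
  refine ⟨LinearMap.range (jetToLp v n), inferInstance, inferInstance,
    (isClosed_range_jetToLp hv n).completeSpace_coe,
    (weightedSubmodule v n).subtype ∘ₗ e.symm.toLinearMap, ?_, ?_, ?_⟩
  · exact Subtype.val_injective.comp e.symm.injective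
  · ext F
    rw [Set.mem_ofPred_eq, ← memLp_jet_iff hvm, ← mem_weightedSubmodule]
    constructor
    · rintro ⟨f, rfl⟩
      exact (e.symm f).2
    · exact fun h => ⟨e ⟨F, h⟩, by simp⟩
  · intro f
    obtain ⟨F, rfl⟩ := e.surjective f
    simp only [LinearMap.comp_apply, LinearEquiv.coe_coe, e.symm_apply_apply,
      Submodule.subtype_apply]
    rw [weightedNormSq_eq_norm_jetToLp hvm]
    rfl

/-! ### Polynomials, the shift and dilations in the weighted norm. -/

theorem Polynomial.iteratedDeriv_eval (P : ℂ[X]) (k : ℕ) :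
    iteratedDeriv k (fun z => P.eval z) = fun z => (derivative^[k] P).eval z := by
  induction k with
  | zero => simp
  | succ k ih =>
    rw [iteratedDeriv_succ, ih, Function.iterate_succ_apply']
    ext z
    exact Polynomial.deriv _

theorem polyOn_eqOn (P : ℂ[X]) : Set.EqOn (polyOn disk P : ℂ → ℂ) (fun z => P.eval z) disk :=
  fun _ hz => if_pos hz

theorem iteratedDeriv_polyOn (P : ℂ[X]) (k : ℕ) {z : ℂ} (hz : z ∈ disk) :
    iteratedDeriv k (polyOn disk P : ℂ → ℂ) z = (derivative^[k] P).eval z := by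
  rw [(polyOn_eqOn P).iteratedDeriv_of_isOpen Metric.isOpen_ball k hz, P.iteratedDeriv_eval]

open Filter Topology in
/-- Taylor polynomials converge locally uniformly. -/
theorem exists_polynomial_tendstoLocallyUniformlyOn {f : ℂ → ℂ} {R : NNReal} (hR : 0 < R)
    (hf : DifferentiableOn ℂ f (Metric.closedBall 0 R)) :
    ∃ P : ℕ → ℂ[X], TendstoLocallyUniformlyOn (fun j z => (P j).eval z) f atTop
      (Metric.ball 0 R) := by
  have h := (hf.hasFPowerSeriesOnBall hR).tendstoLocallyUniformlyOn
  rw [Metric.eball_coe] at h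
  simp only [zero_add] at h
  refine ⟨fun j => ∑ i ∈ Finset.range j, C ((cauchyPowerSeries f 0 R).coeff i) * X ^ i, ?_⟩
  convert h using 3 with j z
  rw [FormalMultilinearSeries.partialSum, Polynomial.eval_finsetSum]
  refine Finset.sum_congr rfl fun i _ => ?_
  rw [FormalMultilinearSeries.apply_eq_pow_smul_coeff, eval_mul, eval_C, eval_pow, eval_X,
    smul_eq_mul, mul_comm]

theorem weightedNormSq_le_of_norm_sq_le {v : ℂ → ℝ} {n : ℕ} {F : ℂ → ℂ} {M : ℝ}
    (h : ∀ k ≤ n, ∀ z ∈ disk, ‖iteratedDeriv k F z‖ ^ 2 ≤ M) :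
    weightedNormSq v n F ≤ (n + 1) * (ENNReal.ofReal M * ∫⁻ z, ENNReal.ofReal (v z) ∂diskArea) := by
  have : ∀ k ∈ Finset.range (n + 1),
      ∫⁻ z, ENNReal.ofReal (‖iteratedDeriv k F z‖ ^ 2 * v z) ∂diskArea ≤
        ENNReal.ofReal M * ∫⁻ z, ENNReal.ofReal (v z) ∂diskArea := fun k hk => by
    rw [← lintegral_const_mul' _ _ ENNReal.ofReal_ne_top]
    refine lintegral_mono_ae ?_
    filter_upwards [ae_diskArea_mem] with z hz
    rw [ENNReal.ofReal_mul (by positivity)]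
    gcongr
    exact h k (Nat.lt_succ_iff.1 (Finset.mem_range.1 hk)) z hz
  refine (Finset.sum_le_card_nsmul _ _ _ this).trans ?_
  simp

/-- Here the function and the weight are estimated jointly, so that decay of `v` can compensate for
a function that is not small everywhere. -/
theorem weightedNormSq_le_of_norm_sq_mul_le {v : ℂ → ℝ} {n : ℕ} {F : ℂ → ℂ} {B : ℝ}
    (h : ∀ k ≤ n, ∀ z ∈ disk, ‖iteratedDeriv k F z‖ ^ 2 * v z ≤ B) :
    weightedNormSq v n F ≤ (n + 1) * (ENNReal.ofReal B * diskArea Set.univ) := by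
  have : ∀ k ∈ Finset.range (n + 1),
      ∫⁻ z, ENNReal.ofReal (‖iteratedDeriv k F z‖ ^ 2 * v z) ∂diskArea ≤
        ENNReal.ofReal B * diskArea Set.univ := fun k hk => by
    rw [← lintegral_const]
    refine lintegral_mono_ae ?_
    filter_upwards [ae_diskArea_mem] with z hz
    exact ENNReal.ofReal_le_ofReal (h k (Nat.lt_succ_iff.1 (Finset.mem_range.1 hk)) z hz)
  refine (Finset.sum_le_card_nsmul _ _ _ this).trans ?_
  simp

theorem lintegral_ofReal_weight_lt_top {v : ℂ → ℝ} (hv : IsAdmissibleWeight v) :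
    ∫⁻ z, ENNReal.ofReal (v z) ∂diskArea < ⊤ :=
  hv.1.lintegral_lt_top

theorem weightedNormSq_polyOn_lt_top {v : ℂ → ℝ} (hv : IsAdmissibleWeight v) (n : ℕ) (P : ℂ[X]) :
    weightedNormSq v n (polyOn disk P : ℂ → ℂ) < ⊤ := by
  have hb : ∀ k, ∃ M : ℝ, ∀ z ∈ disk, ‖iteratedDeriv k (polyOn disk P : ℂ → ℂ) z‖ ^ 2 ≤ M := by
    intro k
    obtain ⟨M, hM⟩ := (isCompact_closedBall (0 : ℂ) 1).exists_bound_of_continuousOn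
      (f := fun z => (derivative^[k] P).eval z ^ 2) (by fun_prop)
    refine ⟨M, fun z hz => ?_⟩
    rw [iteratedDeriv_polyOn P k hz, ← norm_pow]
    exact hM z (Metric.ball_subset_closedBall hz)
  choose M hM using hb
  refine (weightedNormSq_le_of_norm_sq_le (M := ∑ k ∈ Finset.range (n + 1), M k)
    fun k hk z hz => (hM k z hz).trans (Finset.single_le_sum (f := M)
      (fun i _ => (sq_nonneg _).trans (hM i z hz)) (Finset.mem_range.2 (by omega)))).trans_lt ?_
  exact ENNReal.mul_lt_top (by simp) (ENNReal.mul_lt_top ENNReal.ofReal_lt_top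
    (lintegral_ofReal_weight_lt_top hv))

/-- Multiplication by the coordinate. -/
noncomputable def Hol.shift : Hol disk →ₗ[ℂ] Hol disk where
  toFun F := Hol.ofDifferentiableOn (fun z => z * (F : ℂ → ℂ) z) (differentiableOn_id.mul F.2.1)
  map_add' F G := Hol.ext_disk fun z hz => by
    simp [Hol.ofDifferentiableOn, Set.indicator_of_mem hz, mul_add]
  map_smul' c F := Hol.ext_disk fun z hz => by
    simp [Hol.ofDifferentiableOn, Set.indicator_of_mem hz, mul_left_comm]

theorem Hol.shift_eqOn (F : Hol disk) :
    Set.EqOn (Hol.shift F : ℂ → ℂ) (fun z => z * (F : ℂ → ℂ) z) disk :=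
  Hol.eqOn_ofDifferentiableOn (differentiableOn_id.mul F.2.1)

/-- This is Leibniz's rule. At `k = 0` the truncated `k - 1` is harmless, as its coefficient
vanishes. -/
theorem Hol.iteratedDeriv_shift (F : Hol disk) (k : ℕ) :
    Set.EqOn (iteratedDeriv k (Hol.shift F : ℂ → ℂ))
      (fun z => z * iteratedDeriv k (F : ℂ → ℂ) z + k * iteratedDeriv (k - 1) (F : ℂ → ℂ) z)
      disk := by
  induction k with
  | zero => exact fun z hz => by simpa using Hol.shift_eqOn F hz
  | succ k ih =>
    intro z hz
    have hd : ∀ j, DifferentiableAt ℂ (iteratedDeriv j (F : ℂ → ℂ)) z := fun j =>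
      (F.2.1.iteratedDeriv_of_isOpen Metric.isOpen_ball j).differentiableAt
        (Metric.isOpen_ball.mem_nhds hz)
    rw [iteratedDeriv_succ,
      (ih.eventuallyEq_of_mem (Metric.isOpen_ball.mem_nhds hz)).deriv_eq,
      (((hasDerivAt_id' z).fun_mul (hd k).hasDerivAt).fun_add
        ((hd (k - 1)).hasDerivAt.const_mul (k : ℂ))).deriv]
    simp only [← iteratedDeriv_succ, Nat.add_sub_cancel]
    cases k with
    | zero => simp [add_comm]
    | succ k => push_cast; ring

theorem weightedNormSq_shift_le {v : ℂ → ℝ} (hv : AEMeasurable v diskArea) (n : ℕ) (F : Hol disk) :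
    weightedNormSq v n (Hol.shift F : ℂ → ℂ) ≤
      ENNReal.ofReal ((n + 1) * (2 + 2 * n ^ 2)) * weightedNormSq v n (F : ℂ → ℂ) := by
  set t : ℕ → ENNReal := fun k =>
    ∫⁻ z, ENNReal.ofReal (‖iteratedDeriv k (F : ℂ → ℂ) z‖ ^ 2 * v z) ∂diskArea with ht
  have hle : ∀ k ≤ n, t k ≤ weightedNormSq v n (F : ℂ → ℂ) := fun k hk =>
    Finset.single_le_sum (f := t) (fun _ _ => zero_le) (Finset.mem_range.2 (by omega))
  have hm : ∀ k, AEMeasurable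
      (fun z => ENNReal.ofReal (‖iteratedDeriv k (F : ℂ → ℂ) z‖ ^ 2 * v z)) diskArea := fun k =>
    (((iteratedDeriv_aemeasurable F k).norm.pow_const 2).mul hv).ennreal_ofReal
  have hterm : ∀ k ∈ Finset.range (n + 1),
      ∫⁻ z, ENNReal.ofReal (‖iteratedDeriv k (Hol.shift F : ℂ → ℂ) z‖ ^ 2 * v z) ∂diskArea ≤
        ENNReal.ofReal (2 + 2 * n ^ 2) * weightedNormSq v n (F : ℂ → ℂ) := by
    intro k hk
    have hk' : k ≤ n := Nat.lt_succ_iff.1 (Finset.mem_range.1 hk)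
    calc ∫⁻ z, ENNReal.ofReal (‖iteratedDeriv k (Hol.shift F : ℂ → ℂ) z‖ ^ 2 * v z) ∂diskArea
        ≤ ∫⁻ z, (ENNReal.ofReal 2 * ENNReal.ofReal (‖iteratedDeriv k (F : ℂ → ℂ) z‖ ^ 2 * v z) +
            ENNReal.ofReal (2 * n ^ 2) *
              ENNReal.ofReal (‖iteratedDeriv (k - 1) (F : ℂ → ℂ) z‖ ^ 2 * v z)) ∂diskArea := by
          refine lintegral_mono_ae ?_
          filter_upwards [ae_diskArea_mem] with z hz
          rw [Hol.iteratedDeriv_shift F k hz]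
          set a := iteratedDeriv k (F : ℂ → ℂ) z
          set b := iteratedDeriv (k - 1) (F : ℂ → ℂ) z
          have hz1 : ‖z‖ ≤ 1 := (mem_ball_zero_iff.1 hz).le
          have hkn : (k : ℝ) ≤ n := by exact_mod_cast hk'
          have h1 : ‖z * a + k * b‖ ≤ ‖a‖ + n * ‖b‖ := by
            refine (norm_add_le _ _).trans ?_
            rw [norm_mul, norm_mul, Complex.norm_natCast]
            gcongr
            exact mul_le_of_le_one_left (norm_nonneg _) hz1
          have h2 : ‖z * a + k * b‖ ^ 2 ≤ 2 * ‖a‖ ^ 2 + 2 * n ^ 2 * ‖b‖ ^ 2 :=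
            calc ‖z * a + k * b‖ ^ 2 ≤ (‖a‖ + n * ‖b‖) ^ 2 := by gcongr
              _ ≤ _ := by nlinarith [sq_nonneg (‖a‖ - n * ‖b‖)]
          rw [ENNReal.ofReal_mul (sq_nonneg ‖z * a + k * b‖), ENNReal.ofReal_mul (sq_nonneg ‖a‖),
            ENNReal.ofReal_mul (sq_nonneg ‖b‖), ← mul_assoc, ← mul_assoc, ← add_mul,
            ← ENNReal.ofReal_mul zero_le_two,
            ← ENNReal.ofReal_mul (p := 2 * (n : ℝ) ^ 2) (by positivity),
            ← ENNReal.ofReal_add (by positivity) (by positivity)]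
          gcongr
      _ = ENNReal.ofReal 2 * t k + ENNReal.ofReal (2 * n ^ 2) * t (k - 1) := by
          rw [lintegral_add_left' ((hm k).const_mul _),
            lintegral_const_mul' _ _ ENNReal.ofReal_ne_top,
            lintegral_const_mul' _ _ ENNReal.ofReal_ne_top]
      _ ≤ ENNReal.ofReal 2 * weightedNormSq v n (F : ℂ → ℂ) +
            ENNReal.ofReal (2 * n ^ 2) * weightedNormSq v n (F : ℂ → ℂ) := by
          gcongr
          · exact hle k hk'
          · exact hle _ (by omega)
      _ = _ := by rw [← add_mul, ← ENNReal.ofReal_add (by positivity) (by positivity)]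
  refine (Finset.sum_le_card_nsmul _ _ _ hterm).trans (le_of_eq ?_)
  rw [Finset.card_range, nsmul_eq_mul, ENNReal.ofReal_mul (by positivity), ← mul_assoc]
  congr 2
  rw [← Nat.cast_add_one, ENNReal.ofReal_natCast]

theorem Hol.differentiableOn_comp_mul {r : ℝ} (hr : |r| ≤ 1) (F : Hol disk) :
    DifferentiableOn ℂ (fun z => (F : ℂ → ℂ) (r * z)) disk :=
  F.2.1.comp ((differentiableOn_const _).mul differentiableOn_id) fun z hz => by
    rw [disk, mem_ball_zero_iff] at *
    simp only [norm_mul, Complex.norm_real, Real.norm_eq_abs]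
    nlinarith [norm_nonneg z, abs_nonneg r]

/-- The dilation `F ↦ F(r ·)`. -/
noncomputable def Hol.dilate (r : ℝ) (hr : |r| ≤ 1) : Hol disk →ₗ[ℂ] Hol disk where
  toFun F := Hol.ofDifferentiableOn _ (Hol.differentiableOn_comp_mul hr F)
  map_add' F G := Hol.ext_disk fun z hz => by
    simp [Hol.ofDifferentiableOn, Set.indicator_of_mem hz]
  map_smul' c F := Hol.ext_disk fun z hz => by
    simp [Hol.ofDifferentiableOn, Set.indicator_of_mem hz]

theorem Hol.dilate_eqOn {r : ℝ} (hr : |r| ≤ 1) (F : Hol disk) :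
    Set.EqOn (Hol.dilate r hr F : ℂ → ℂ) (fun z => (F : ℂ → ℂ) (r * z)) disk :=
  Hol.eqOn_ofDifferentiableOn (Hol.differentiableOn_comp_mul hr F)

theorem iteratedDeriv_comp_const_mul_field (c : ℂ) (f : ℂ → ℂ) (k : ℕ) :
    iteratedDeriv k (fun z => f (c * z)) = fun z => c ^ k * iteratedDeriv k f (c * z) := by
  induction k with
  | zero => simp
  | succ k ih =>
    ext z
    rw [iteratedDeriv_succ, ih, deriv_const_mul_field, deriv_comp_mul_left, iteratedDeriv_succ,
      smul_eq_mul]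
    ring

theorem lintegral_comp_mul_diskArea_le {r : ℝ} (hr : 0 < r) (hr1 : r ≤ 1) (g : ℂ → ENNReal) :
    ∫⁻ z, g (r * z) ∂diskArea ≤ ENNReal.ofReal (r ^ 2)⁻¹ * ∫⁻ z, g z ∂diskArea := by
  have hmap : ∀ h : ℂ → ENNReal, ∫⁻ z, h (r * z) = ENNReal.ofReal (r ^ 2)⁻¹ * ∫⁻ z, h z := by
    intro h
    have h1 := Measure.map_addHaar_smul (volume : Measure ℂ) hr.ne'
    rw [Complex.finrank_real_complex, abs_of_pos (by positivity)] at h1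
    rw [← smul_eq_mul, ← lintegral_smul_measure, ← h1,
      (measurableEmbedding_const_smul₀ hr.ne').lintegral_map]
    simp
  simp only [diskArea, lintegral_smul_measure, ← lintegral_indicator measurableSet_ball]
  simp only [smul_eq_mul]
  rw [mul_left_comm, ← hmap]
  gcongr with z
  refine Set.indicator_apply_le' (fun hz => ?_) fun _ => zero_le
  rw [Set.indicator_of_mem]
  rw [mem_ball_zero_iff] at *
  simp only [norm_mul, Complex.norm_real, Real.norm_eq_abs, abs_of_pos hr]
  nlinarith [norm_nonneg z]

/-- Radial monotonicity replaces `v z` by `v (r * z)`, after which the integrand is a function of `r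
* z` and a change of variables applies; the factors `r ^ k` from the chain rule are at most 1 in
modulus. -/
theorem weightedNormSq_dilate_le {v : ℂ → ℝ} (hv : IsAdmissibleWeight v) (n : ℕ) {r : ℝ}
    (hr : 0 < r) (hr1 : r < 1) (hr' : |r| ≤ 1) (F : Hol disk) :
    weightedNormSq v n (Hol.dilate r hr' F : ℂ → ℂ) ≤
      ENNReal.ofReal (r ^ 2)⁻¹ * weightedNormSq v n (F : ℂ → ℂ) := by
  rw [weightedNormSq, weightedNormSq, Finset.mul_sum]
  refine Finset.sum_le_sum fun k _ => ?_
  refine le_trans (lintegral_mono_ae ?_) (lintegral_comp_mul_diskArea_le hr hr1.le _)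
  filter_upwards [hv.2.2 r hr hr1, ae_diskArea_mem] with z hz hzd
  rw [(Hol.dilate_eqOn hr' F).iteratedDeriv_of_isOpen Metric.isOpen_ball k hzd,
    iteratedDeriv_comp_const_mul_field, ENNReal.ofReal_mul (by positivity),
    ENNReal.ofReal_mul (by positivity)]
  gcongr
  rw [norm_mul, norm_pow, Complex.norm_real, Real.norm_eq_abs]
  exact mul_le_of_le_one_left (norm_nonneg _) (pow_le_one₀ (abs_nonneg r) hr')

/-! ### Weak limits, density of polynomials and the maximal domain. -/

open Filter Topology in
/-- A closed subspace of a Hilbert space contains the limit of a bounded sequence of its elements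
with respect to a separating set of functionals. -/
theorem Submodule.mem_of_bounded_of_tendsto {H : Type*} [NormedAddCommGroup H]
    [InnerProductSpace ℂ H] [CompleteSpace H] {M : Submodule ℂ H} (hM : IsClosed (M : Set H))
    {S : Set (H →L[ℂ] ℂ)} (hS : ∀ x, (∀ l ∈ S, l x = 0) → x = 0) {x : ℕ → H} {y : H} {B : ℝ}
    (hx : ∀ m, x m ∈ M) (hB : ∀ m, ‖x m‖ ≤ B)
    (hlim : ∀ l ∈ S, Tendsto (fun m => l (x m)) atTop (𝓝 (l y))) : y ∈ M := by
  -- `N` consists of the vectors that test weak convergence of `x` to `y`. It is closed because `x`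
  -- is bounded, and it contains the Riesz representatives of `S`, so it is everything.
  let N : Submodule ℂ H :=
    { carrier := {u | Tendsto (fun m => inner ℂ u (x m)) atTop (𝓝 (inner ℂ u y))}
      add_mem' := fun {u w} hu hw => by
        simp only [Set.mem_ofPred_eq, inner_add_left] at *
        exact hu.add hw
      zero_mem' := by simp
      smul_mem' := fun c u hu => by
        simp only [Set.mem_ofPred_eq, inner_smul_left] at *
        exact hu.const_mul _ }
  have hmemN : ∀ u, u ∈ N ↔ Tendsto (fun m => inner ℂ u (x m)) atTop (𝓝 (inner ℂ u y)) :=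
    fun u => Iff.rfl
  have hNc : IsClosed (N : Set H) := by
    refine isClosed_of_closure_subset fun u hu => ?_
    have hB0 : 0 ≤ B := (norm_nonneg _).trans (hB 0)
    rw [SetLike.mem_coe, hmemN, Metric.tendsto_atTop]
    intro ε hε
    obtain ⟨w, hw, huw⟩ := Metric.mem_closure_iff.1 hu (ε / (2 * (B + ‖y‖ + 1))) (by positivity)
    obtain ⟨m₀, hm₀⟩ := Metric.tendsto_atTop.1 ((hmemN w).1 hw) (ε / 2) (by positivity)
    refine ⟨m₀, fun m hm => ?_⟩
    have h1 := hm₀ m hm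
    rw [dist_eq_norm, ← inner_sub_right] at h1 ⊢
    rw [dist_eq_norm] at huw
    have h2 : inner ℂ u (x m - y) = inner ℂ (u - w) (x m - y) + inner ℂ w (x m - y) := by
      rw [inner_sub_left]; ring
    have h3 : ‖inner ℂ (u - w) (x m - y)‖ ≤ ε / 2 := by
      refine (norm_inner_le_norm _ _).trans ?_
      calc ‖u - w‖ * ‖x m - y‖ ≤ ε / (2 * (B + ‖y‖ + 1)) * (B + ‖y‖ + 1) := by
            gcongr
            linarith [norm_sub_le (x m) y, hB m]
        _ = ε / 2 := by field_simp
    rw [h2]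
    linarith [norm_add_le (inner ℂ (u - w) (x m - y)) (inner ℂ w (x m - y))]
  have : CompleteSpace N := hNc.completeSpace_coe
  have : CompleteSpace M := hM.completeSpace_coe
  have hN : N = ⊤ := by
    rw [← Submodule.orthogonal_eq_bot_iff, Submodule.eq_bot_iff]
    intro z hz
    refine hS z fun l hl => ?_
    have hmem : (InnerProductSpace.toDual ℂ H).symm l ∈ N := by
      rw [hmemN]
      simpa only [InnerProductSpace.toDual_symm_apply] using hlim l hl
    simpa only [InnerProductSpace.toDual_symm_apply] using
      (Submodule.mem_orthogonal N z).1 hz _ hmem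
  -- A closed subspace is its own double orthogonal complement, and each orthogonality relation
  -- passes to the weak limit.
  rw [← M.orthogonal_orthogonal, Submodule.mem_orthogonal]
  intro u hu
  have h1 : Tendsto (fun m => inner ℂ u (x m)) atTop (𝓝 (inner ℂ u y)) :=
    (hmemN u).1 (hN ▸ Submodule.mem_top)
  have h2 : ∀ m, inner ℂ u (x m) = 0 := fun m => (Submodule.mem_orthogonal' M u).1 hu _ (hx m)
  simp only [h2] at h1
  exact (tendsto_nhds_unique h1 tendsto_const_nhds)

namespace IsWeightedSpace

variable {H : Type*} [NormedAddCommGroup H] [InnerProductSpace ℂ H] {v : ℂ → ℝ} {n : ℕ}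
  {ι : H →ₗ[ℂ] Hol disk}

theorem weightedNormSq_eq (hι : IsWeightedSpace v n ι) (f : H) :
    weightedNormSq v n (ι f : ℂ → ℂ) = ENNReal.ofReal (‖f‖ ^ 2) := (hι.2.2 f).symm

theorem exists_eq (hι : IsWeightedSpace v n ι) {F : Hol disk}
    (hF : weightedNormSq v n (F : ℂ → ℂ) < ⊤) : ∃ f : H, ι f = F := by
  have : F ∈ Set.range ι := by rw [hι.2.1]; exact hF
  exact this

/-- An operator on holomorphic functions that is bounded for the weighted norm acts on the
weighted space. -/
theorem exists_clm (hι : IsWeightedSpace v n ι) (A : Hol disk →ₗ[ℂ] Hol disk) {C : ℝ} (hC : 0 ≤ C)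
    (hA : ∀ F : Hol disk, weightedNormSq v n (A F : ℂ → ℂ) ≤
      ENNReal.ofReal C * weightedNormSq v n (F : ℂ → ℂ)) :
    ∃ S : H →L[ℂ] H, (∀ f, ι (S f) = A (ι f)) ∧ ∀ f, ‖S f‖ ≤ √C * ‖f‖ := by
  have hex : ∀ f : H, ∃ g : H, ι g = A (ι f) := fun f => by
    refine hι.exists_eq ((hA _).trans_lt (ENNReal.mul_lt_top ENNReal.ofReal_lt_top ?_))
    rw [hι.weightedNormSq_eq]
    exact ENNReal.ofReal_lt_top
  choose S hS using hex
  have hb : ∀ f, ‖S f‖ ≤ √C * ‖f‖ := fun f => by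
    have h := hA (ι f)
    rw [← hS, hι.weightedNormSq_eq, hι.weightedNormSq_eq, ← ENNReal.ofReal_mul hC,
      ENNReal.ofReal_le_ofReal_iff (by positivity)] at h
    refine le_of_sq_le_sq ?_ (by positivity)
    rwa [mul_pow, Real.sq_sqrt hC]
  exact ⟨LinearMap.mkContinuous
    { toFun := S
      map_add' := fun f g => hι.1 (by simp [hS])
      map_smul' := fun c f => hι.1 (by simp [hS]) } (√C) hb, hS, hb⟩

theorem exists_eval (hv : IsAdmissibleWeight v) (hι : IsWeightedSpace v n ι) {w : ℂ}
    (hw : w ∈ disk) : ∃ l : H →L[ℂ] ℂ, ∀ f, l f = (ι f : ℂ → ℂ) w := by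
  obtain ⟨r, h1, h2⟩ := exists_between (mem_ball_zero_iff.1 hw)
  obtain ⟨c, hc, hcb⟩ := exists_mul_norm_sq_le hv n ((norm_nonneg w).trans_lt h1) h2
  refine ⟨LinearMap.mkContinuous
    { toFun := fun f => (ι f : ℂ → ℂ) w
      map_add' := fun f g => by simp
      map_smul' := fun a f => by simp } (√c)⁻¹ fun f => ?_, fun f => rfl⟩
  have h := hcb (ι f) ‖f‖ (hι.weightedNormSq_eq f) 0 n.zero_le w (mem_ball_zero_iff.2 h1)
  simp only [iteratedDeriv_zero] at h
  rw [inv_mul_eq_div, le_div_iff₀ (by positivity)]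
  refine le_of_sq_le_sq ?_ (norm_nonneg f)
  rw [mul_pow, Real.sq_sqrt hc.le, mul_comm]
  exact h

theorem evaluationsContinuous (hv : IsAdmissibleWeight v) (hι : IsWeightedSpace v n ι) :
    EvaluationsContinuous ι := fun w hw => by
  obtain ⟨l, hl⟩ := hι.exists_eval hv hw
  exact l.continuous.congr hl

theorem shiftContinuous (hv : IsAdmissibleWeight v) (hι : IsWeightedSpace v n ι) :
    ShiftContinuous ι := by
  obtain ⟨S, hS, -⟩ := hι.exists_clm Hol.shift (by positivity)
    (weightedNormSq_shift_le hv.1.aestronglyMeasurable.aemeasurable n)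
  refine ⟨S, fun f z => ?_⟩
  rw [hS]
  by_cases hz : z ∈ disk
  · exact Hol.shift_eqOn (ι f) hz
  · rw [(Hol.shift _).2.2 z hz, (ι f).2.2 z hz, mul_zero]

theorem exists_polyOn (hv : IsAdmissibleWeight v) (hι : IsWeightedSpace v n ι) (P : ℂ[X]) :
    ∃ f : H, ι f = polyOn disk P := hι.exists_eq (weightedNormSq_polyOn_lt_top hv n P)

open Filter Topology in
/-- Functions that are holomorphic on a larger disk are limits of polynomials. -/
theorem mem_closure_polynomials (hv : IsAdmissibleWeight v) (hι : IsWeightedSpace v n ι)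
    {R : NNReal} (hR : 1 < R) {F : ℂ → ℂ} (hF : DifferentiableOn ℂ F (Metric.closedBall 0 R))
    {f : H} (hf : Set.EqOn (ι f : ℂ → ℂ) F disk) :
    f ∈ closure {f : H | ∃ P : ℂ[X], ι f = polyOn disk P} := by
  obtain ⟨P, hP⟩ := exists_polynomial_tendstoLocallyUniformlyOn (zero_lt_one.trans hR) hF
  have hsub : Metric.closedBall (0 : ℂ) 1 ⊆ Metric.ball 0 R :=
    Metric.closedBall_subset_ball (by exact_mod_cast hR)
  have hunif : ∀ k, TendstoUniformlyOn (fun j => iteratedDeriv k fun z => (P j).eval z)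
      (iteratedDeriv k F) atTop (Metric.closedBall 0 1) := fun k =>
    (tendstoLocallyUniformlyOn_iff_forall_isCompact Metric.isOpen_ball).1
      (hP.iteratedDeriv Metric.isOpen_ball (fun j => (P j).differentiable.differentiableOn) k)
      _ hsub (isCompact_closedBall 0 1)
  set V : ℝ := (∫⁻ z, ENNReal.ofReal (v z) ∂diskArea).toReal with hV
  rw [Metric.mem_closure_iff]
  intro ε hε
  -- Chosen so that `(n + 1) * η ^ 2 * V < ε ^ 2`; the `+ 1` after `V` makes this strict and
  -- excludes division by zero.
  set η : ℝ := ε / √((n + 1) * (V + 1)) with hη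
  have hV0 : 0 ≤ V := ENNReal.toReal_nonneg
  have hη0 : 0 < η := by positivity
  have hev : ∀ᶠ j in atTop, ∀ k ∈ Finset.range (n + 1), ∀ z ∈ Metric.closedBall (0 : ℂ) 1,
      dist (iteratedDeriv k F z) (iteratedDeriv k (fun z => (P j).eval z) z) < η :=
    (Filter.eventually_all_finset _).2 fun k _ => Metric.tendstoUniformlyOn_iff.1 (hunif k) η hη0
  obtain ⟨j, hj⟩ := hev.exists
  obtain ⟨g, hg⟩ := hι.exists_polyOn hv (P j)
  refine ⟨g, ⟨P j, hg⟩, ?_⟩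
  have hd : ∀ k ≤ n, ∀ z ∈ disk,
      ‖iteratedDeriv k (ι (f - g) : ℂ → ℂ) z‖ ^ 2 ≤ η ^ 2 := by
    intro k hk z hz
    have hcd : ∀ G : Hol disk, ContDiffAt ℂ (k : ℕ) (G : ℂ → ℂ) z := fun G =>
      (G.2.1.contDiffOn Metric.isOpen_ball).contDiffAt (Metric.isOpen_ball.mem_nhds hz)
    have h1 := hj k (Finset.mem_range.2 (by omega)) z (Metric.ball_subset_closedBall hz)
    rw [map_sub, Submodule.coe_sub, iteratedDeriv_sub (hcd _) (hcd _), hg,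
      hf.iteratedDeriv_of_isOpen Metric.isOpen_ball k hz,
      (polyOn_eqOn (P j)).iteratedDeriv_of_isOpen Metric.isOpen_ball k hz, ← dist_eq_norm]
    gcongr
  have h := weightedNormSq_le_of_norm_sq_le (v := v) hd
  rw [hι.weightedNormSq_eq, ← ENNReal.ofReal_toReal (lintegral_ofReal_weight_lt_top hv).ne,
    ← hV, ← ENNReal.ofReal_mul (by positivity), ← ENNReal.ofReal_natCast, ← ENNReal.ofReal_one,
    ← ENNReal.ofReal_add (by positivity) zero_le_one, ← ENNReal.ofReal_mul (by positivity),
    ENNReal.ofReal_le_ofReal_iff (by positivity)] at h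
  rw [dist_eq_norm]
  refine lt_of_pow_lt_pow_left₀ 2 hε.le (h.trans_lt ?_)
  rw [hη, div_pow, Real.sq_sqrt (by positivity)]
  have : (n + 1) * (ε ^ 2 / ((n + 1) * (V + 1)) * V) = ε ^ 2 * (V / (V + 1)) := by field_simp
  rw [this]
  refine mul_lt_of_lt_one_right (by positivity) ?_
  rw [div_lt_one (by positivity)]
  linarith

/-- The polynomials, as a subspace of the weighted space. -/
def polynomials (ι : H →ₗ[ℂ] Hol disk) : Submodule ℂ H where
  carrier := {f | ∃ P : ℂ[X], ι f = polyOn disk P}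
  add_mem' := by
    rintro f g ⟨P, hP⟩ ⟨Q, hQ⟩
    refine ⟨P + Q, Hol.ext_disk fun z hz => ?_⟩
    rw [map_add, hP, hQ, polyOn_eqOn _ hz]
    simp [polyOn_eqOn _ hz]
  zero_mem' := ⟨0, Hol.ext_disk fun z hz => by simp [polyOn_eqOn _ hz]⟩
  smul_mem' := by
    rintro c f ⟨P, hP⟩
    refine ⟨c • P, Hol.ext_disk fun z hz => ?_⟩
    rw [map_smul, hP, polyOn_eqOn _ hz]
    simp [polyOn_eqOn _ hz]

open Filter Topology in
-- The dilates of `f` lie in the closure of the polynomials, are bounded in norm and converge to `f`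
-- at every point of the disk. Evaluations separate points, so `f` is a weak limit and lies in the
-- same closed subspace.
theorem polynomialsDense [CompleteSpace H] (hv : IsAdmissibleWeight v)
    (hι : IsWeightedSpace v n ι) : PolynomialsDense ι := by
  refine ⟨hι.exists_polyOn hv, fun f => ?_⟩
  -- Radii of at least `1 / 2` keep the dilation constant `(r ^ 2)⁻¹` below 4 for all `m`.
  have hr : ∀ m : ℕ, (1 / 2 : ℝ) ≤ 1 - 1 / (m + 2) ∧ (1 - 1 / (m + 2) : ℝ) < 1 := fun m => by
    have h1 : (1 : ℝ) / (m + 2) ≤ 1 / 2 := by gcongr; linarith [(Nat.cast_nonneg m : (0 : ℝ) ≤ m)]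
    have h2 : (0 : ℝ) < 1 / (m + 2) := by positivity
    constructor <;> linarith
  set r : ℕ → ℝ := fun m => 1 - 1 / (m + 2) with hr_def
  have hrlim : Tendsto r atTop (𝓝 1) := by
    have : Tendsto (fun m : ℕ => (1 : ℝ) / (m + 2)) atTop (𝓝 0) := by
      refine (tendsto_one_div_atTop_nhds_zero_nat.comp (tendsto_add_atTop_nat 2)).congr fun m => ?_
      simp
    simpa [hr_def] using (tendsto_const_nhds (x := (1 : ℝ))).sub this
  have hrabs : ∀ m, |r m| ≤ 1 := fun m => by
    rw [abs_of_nonneg (by linarith [(hr m).1])]; exact (hr m).2.le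
  have hclm : ∀ m, ∃ g : H, ι g = Hol.dilate (r m) (hrabs m) (ι f) ∧ ‖g‖ ≤ √4 * ‖f‖ := fun m => by
    have h0 : 0 < r m := by linarith [(hr m).1]
    obtain ⟨S, hS, hSb⟩ := hι.exists_clm (Hol.dilate (r m) (hrabs m)) (C := 4) (by norm_num)
      fun F => by
        refine (weightedNormSq_dilate_le hv n h0 (hr m).2 (hrabs m) F).trans ?_
        gcongr
        rw [inv_le_comm₀ (by positivity) (by norm_num)]
        nlinarith [(hr m).1]
    exact ⟨S f, hS f, hSb f⟩
  choose x hx hxb using hclm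
  change f ∈ closure ((polynomials ι : Submodule ℂ H) : Set H)
  rw [← Submodule.topologicalClosure_coe]
  refine Submodule.mem_of_bounded_of_tendsto (Submodule.isClosed_topologicalClosure _)
    (S := {l | ∃ w ∈ disk, ∀ f, l f = (ι f : ℂ → ℂ) w}) ?_ (x := x) ?_ hxb ?_
  · intro g hg
    refine hι.1 (Hol.ext_disk fun w hw => ?_)
    obtain ⟨l, hl⟩ := hι.exists_eval hv hw
    simpa [hl] using hg l ⟨w, hw, hl⟩
  · intro m
    rw [← SetLike.mem_coe, Submodule.topologicalClosure_coe]
    have h0 : 0 < r m := by linarith [(hr m).1]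
    -- The dilate is holomorphic on the disk of radius `1 / r m`, hence near a closed disk of some
    -- radius `R > 1`.
    obtain ⟨R, hR1, hR2⟩ := exists_between (one_lt_one_div h0 (hr m).2)
    lift R to NNReal using by linarith
    refine hι.mem_closure_polynomials hv (R := R) (F := fun z => (ι f : ℂ → ℂ) (r m * z))
      (by exact_mod_cast hR1) ?_ ?_
    · refine (ι f).2.1.comp ((differentiableOn_const _).mul differentiableOn_id) fun z hz => ?_
      rw [mem_closedBall_zero_iff] at hz
      rw [disk, mem_ball_zero_iff]
      simp only [norm_mul, Complex.norm_real, Real.norm_eq_abs, abs_of_pos h0]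
      rw [lt_div_iff₀ h0] at hR2
      calc r m * ‖z‖ ≤ r m * R := by gcongr
        _ < 1 := by linarith
    · rw [hx]
      exact Hol.dilate_eqOn _ _
  · rintro l ⟨w, hw, hl⟩
    simp only [hl, hx]
    simp only [Hol.dilate_eqOn _ _ hw]
    have hc : ContinuousAt (ι f : ℂ → ℂ) w :=
      ((ι f).2.1.differentiableAt (Metric.isOpen_ball.mem_nhds hw)).continuousAt
    refine hc.tendsto.comp ?_
    have : Tendsto (fun m => (r m : ℂ) * w) atTop (𝓝 ((1 : ℝ) * w)) :=
      ((Complex.continuous_ofReal.tendsto 1).comp hrlim).mul_const w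
    simpa using this

/-- Membership in the maximal domain, as a bound for polynomials. -/
theorem mem_maximalDomain_of_bound {w : ℂ} {C : ℝ}
    (h : ∀ (f : H) (P : ℂ[X]), ι f = polyOn disk P → ‖P.eval w‖ ≤ C * ‖f‖) :
    w ∈ maximalDomain ι := by
  -- Uniqueness of the polynomial makes `P ↦ P(w)` a well-defined functional on a subspace;
  -- Hahn–Banach then extends it.
  have huniq : ∀ P Q : ℂ[X], polyOn disk P = polyOn disk Q → P = Q := fun P Q hPQ => by
    refine Polynomial.eq_of_infinite_eval_eq P Q
      ((infinite_of_mem_nhds (0 : ℂ) (Metric.isOpen_ball.mem_nhds (Metric.mem_ball_self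
        zero_lt_one) : disk ∈ nhds (0 : ℂ))).mono fun z hz => ?_)
    exact (polyOn_eqOn P hz).symm.trans (hPQ ▸ polyOn_eqOn Q hz)
  choose P hP using fun f : polynomials ι => f.2
  have hPeq : ∀ (f : polynomials ι) (Q : ℂ[X]), ι f = polyOn disk Q → P f = Q := fun f Q hQ =>
    huniq _ _ ((hP f).symm.trans hQ)
  let φ : polynomials ι →ₗ[ℂ] ℂ :=
    { toFun := fun f => (P f).eval w
      map_add' := fun f g => by
        rw [hPeq (f + g) (P f + P g), eval_add]
        refine Hol.ext_disk fun z hz => ?_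
        simp [hP, polyOn_eqOn _ hz]
      map_smul' := fun c f => by
        rw [hPeq (c • f) (c • P f), eval_smul, RingHom.id_apply]
        refine Hol.ext_disk fun z hz => ?_
        simp [hP, polyOn_eqOn _ hz] }
  obtain ⟨L, hL, -⟩ := exists_extension_norm_eq (polynomials ι)
    (φ.mkContinuous C fun f => h f (P f) (hP f))
  refine ⟨L, fun f Q hQ => ?_⟩
  rw [hL ⟨f, Q, hQ⟩]
  exact congrArg (eval w) (hPeq ⟨f, Q, hQ⟩ Q hQ)

theorem disk_subset_maximalDomain (hv : IsAdmissibleWeight v) (hι : IsWeightedSpace v n ι) :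
    disk ⊆ maximalDomain ι := fun w hw => by
  obtain ⟨l, hl⟩ := hι.exists_eval hv hw
  refine ⟨l, fun f P hP => ?_⟩
  rw [hl, hP, polyOn_eqOn P hw]

end IsWeightedSpace

/-! ### Bounds for the weight of a single set. -/

theorem circleDist_le_two (ζ : ℂ) (E : Set ℂ) : circleDist ζ E ≤ 2 := by
  have := ENNReal.toReal_mono (by simp) (min_le_left 2 (Metric.infEDist ζ E))
  simpa [circleDist] using this

theorem circleDist_nonneg (ζ : ℂ) (E : Set ℂ) : 0 ≤ circleDist ζ E := ENNReal.toReal_nonneg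

theorem circleDist_le_norm_sub {ζ w : ℂ} {E : Set ℂ} (hw : w ∈ E) :
    circleDist ζ E ≤ ‖ζ - w‖ := by
  rw [circleDist, ← dist_eq_norm, dist_edist]
  exact ENNReal.toReal_mono (edist_ne_top _ _)
    ((min_le_right _ _).trans (Metric.infEDist_le_edist_of_mem hw))

/-- Distance to a set is 1-Lipschitz; the condition `d ≤ 2` accommodates the cap at 2. -/
theorem sub_norm_le_circleDist {ζ w : ℂ} {E : Set ℂ} {d : ℝ} (hd : d ≤ 2)
    (hE : ENNReal.ofReal d ≤ Metric.infEDist w E) : d - ‖w - ζ‖ ≤ circleDist ζ E := by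
  rw [circleDist, ← ENNReal.ofReal_le_iff_le_toReal (by simp)]
  refine le_min ?_ ?_
  · rw [← ENNReal.ofReal_ofNat]
    exact ENNReal.ofReal_le_ofReal (by linarith [norm_nonneg (w - ζ)])
  · rw [ENNReal.ofReal_sub _ (norm_nonneg _), tsub_le_iff_right, ← dist_eq_norm, ← edist_dist]
    exact hE.trans Metric.infEDist_le_infEDist_add_edist

theorem norm_div_norm_sub_self_le {z : ℂ} (hz : z ∈ disk) : ‖z / (‖z‖ : ℂ) - z‖ ≤ 1 - ‖z‖ := by
  have h1 : ‖z‖ ≤ 1 := (mem_ball_zero_iff.1 hz).le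
  rcases eq_or_ne z 0 with rfl | h0
  · simp
  · have hn : (0 : ℝ) < ‖z‖ := norm_pos_iff.2 h0
    have : z / (‖z‖ : ℂ) - z = ((1 - ‖z‖ : ℝ) : ℂ) * (z / (‖z‖ : ℂ)) := by
      have : (‖z‖ : ℂ) ≠ 0 := by exact_mod_cast hn.ne'
      push_cast
      field_simp
    rw [this, norm_mul, norm_div, Complex.norm_real, Complex.norm_real, norm_norm,
      div_self hn.ne', mul_one, Real.norm_of_nonneg (by linarith)]

theorem circleWeight_pos (E : Set ℂ) (z : ℂ) : 0 < circleWeight E z := Real.exp_pos _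

theorem circleWeight_le_one (E : Set ℂ) {z : ℂ} (hz : z ∈ disk) : circleWeight E z ≤ 1 := by
  have h1 : ‖z‖ < 1 := mem_ball_zero_iff.1 hz
  rw [circleWeight, Real.exp_le_one_iff, neg_div, neg_nonpos]
  exact div_nonneg (circleDist_nonneg _ _) (by linarith)

theorem le_circleWeight (E : Set ℂ) {z : ℂ} {r : ℝ} (hr : r < 1) (hz : ‖z‖ ≤ r) :
    Real.exp (-(2 / (1 - r))) ≤ circleWeight E z := by
  rw [circleWeight, Real.exp_le_exp, neg_div, neg_le_neg_iff]
  have := circleDist_le_two (z / (‖z‖ : ℂ)) E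
  have h1 : 0 < 1 - r := by linarith
  gcongr

theorem circleWeight_le_comp_mul (E : Set ℂ) {z : ℂ} (hz : z ∈ disk) {r : ℝ} (hr : 0 < r)
    (hr1 : r < 1) : circleWeight E z ≤ circleWeight E (r * z) := by
  have h1 : ‖z‖ < 1 := mem_ball_zero_iff.1 hz
  have hn : ‖(r : ℂ) * z‖ = r * ‖z‖ := by
    rw [norm_mul, Complex.norm_real, Real.norm_of_nonneg hr.le]
  have hq : (r * z) / ((r * ‖z‖ : ℝ) : ℂ) = z / (‖z‖ : ℂ) := by
    push_cast
    exact mul_div_mul_left _ _ (by exact_mod_cast hr.ne')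
  rw [circleWeight, circleWeight, Real.exp_le_exp, hn, hq, neg_div, neg_div, neg_le_neg_iff]
  have := circleDist_nonneg (z / (‖z‖ : ℂ)) E
  have h2 : r * ‖z‖ ≤ ‖z‖ := mul_le_of_le_one_left (norm_nonneg _) hr1.le
  gcongr

theorem measurable_circleWeight (E : Set ℂ) : Measurable (circleWeight E) := by
  have h : Measurable fun z : ℂ => circleDist (z / (‖z‖ : ℂ)) E := by
    unfold circleDist
    have h1 : Measurable fun z : ℂ => z / (‖z‖ : ℂ) := by fun_prop
    exact ((measurable_const.min (Metric.continuous_infEDist.measurable.comp h1))).ennreal_toReal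
  unfold circleWeight
  exact Real.measurable_exp.comp (h.neg.div (by fun_prop))

/-- The weight is bounded below in a Stolz angle at a point of the set. -/
theorem exp_neg_four_le_circleWeight {E : Set ℂ} {w z : ℂ} (hw : w ∈ E) (hw1 : ‖w‖ = 1) {t : ℝ}
    (ht0 : 0 ≤ t) (ht : t < 1) (hz : z ∈ Metric.ball (t * w) ((1 - t) / 2)) :
    Real.exp (-4) ≤ circleWeight E z := by
  rw [Metric.mem_ball, dist_eq_norm] at hz
  have htw : ‖(t : ℂ) * w‖ = t := by
    rw [norm_mul, Complex.norm_real, Real.norm_of_nonneg ht0, hw1, mul_one]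
  have htw' : ‖(t : ℂ) * w - w‖ = 1 - t := by
    have : (t : ℂ) * w - w = ((t - 1 : ℝ) : ℂ) * w := by push_cast; ring
    rw [this, norm_mul, Complex.norm_real, hw1, mul_one, Real.norm_of_nonpos (by linarith)]
    ring
  have h1 : ‖z‖ ≤ t + (1 - t) / 2 := by
    have := norm_add_le (z - t * w) (t * w)
    rw [sub_add_cancel, htw] at this
    linarith
  have hzd : z ∈ disk := mem_ball_zero_iff.2 (by linarith)
  -- Passing through `z` and `t * w` gives the bound `(1 - ‖z‖) + 3 * (1 - t) / 2`, and `1 - t ≤ 2 *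
  -- (1 - ‖z‖)` by `h1`.
  have h2 : ‖z / (‖z‖ : ℂ) - w‖ ≤ 4 * (1 - ‖z‖) := by
    have e1 := norm_div_norm_sub_self_le hzd
    have e2 := norm_add_le (z / (‖z‖ : ℂ) - z + (z - t * w)) (t * w - w)
    have e3 := norm_add_le (z / (‖z‖ : ℂ) - z) (z - t * w)
    rw [show z / (‖z‖ : ℂ) - z + (z - t * w) + (t * w - w) = z / (‖z‖ : ℂ) - w by ring, htw'] at e2
    linarith
  rw [circleWeight, Real.exp_le_exp, neg_div, neg_le_neg_iff, div_le_iff₀ (by linarith)]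
  exact (circleDist_le_norm_sub hw).trans h2

/-- The weight decays to high order at points of the circle away from the set. -/
theorem circleWeight_le_of_le_infEDist {E : Set ℂ} {w z : ℂ} (hw : ‖w‖ = 1) (hz : z ∈ disk) {d : ℝ}
    (hd : 0 < d) (hd2 : d ≤ 2) (hE : ENNReal.ofReal d ≤ Metric.infEDist w E) :
    circleWeight E z ≤ (Nat.factorial 12 : ℝ) * (4 / d) ^ 12 * ‖w - z‖ ^ 12 := by
  have hs : 0 < 1 - ‖z‖ := sub_pos.2 (mem_ball_zero_iff.1 hz)
  have hsw : 1 - ‖z‖ ≤ ‖w - z‖ := by rw [← hw]; exact norm_sub_norm_le w z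
  have hrw : (Nat.factorial 12 : ℝ) * (4 / d) ^ 12 * ‖w - z‖ ^ 12 =
      (Nat.factorial 12 : ℝ) * (4 * ‖w - z‖ / d) ^ 12 := by ring
  rw [hrw]
  -- Far from `w` the right side exceeds 1. Near `w`, the radial projection of `z` is within `2 * ‖w
  -- - z‖ < d / 2` of `w`, so its distance to `E` is at least `d / 2`; then `exp (-y) ≤ 12! / y ^
  -- 12`.
  rcases le_or_gt (d / 4) ‖w - z‖ with h | h
  · refine (circleWeight_le_one E hz).trans ?_
    have h1 : (1 : ℝ) ≤ 4 * ‖w - z‖ / d := by rw [le_div_iff₀ hd]; linarith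
    have h2 : (1 : ℝ) ≤ (Nat.factorial 12 : ℝ) := by exact_mod_cast Nat.factorial_pos 12
    exact one_le_mul_of_one_le_of_one_le h2 (one_le_pow₀ h1)
  · have h1 := norm_div_norm_sub_self_le hz
    have h2 := sub_norm_le_circleDist (ζ := z / (‖z‖ : ℂ)) hd2 hE
    have h3 : ‖w - z / (‖z‖ : ℂ)‖ ≤ ‖w - z‖ + ‖z / (‖z‖ : ℂ) - z‖ := by
      rw [← norm_neg (z / (‖z‖ : ℂ) - z)]
      refine le_trans (le_of_eq ?_) (norm_add_le _ _)
      congr 1; ring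
    set y := d / (2 * (1 - ‖z‖)) with hy
    have hy0 : 0 < y := by positivity
    have h4 : circleWeight E z ≤ Real.exp (-y) := by
      rw [circleWeight, Real.exp_le_exp, neg_div, neg_le_neg_iff, hy,
        div_le_div_iff₀ (by positivity) hs]
      nlinarith
    have h5 : Real.exp (-y) ≤ (Nat.factorial 12 : ℝ) * (1 / y) ^ 12 := by
      have := Real.pow_div_factorial_le_exp y hy0.le 12
      rw [Real.exp_neg, inv_le_comm₀ (Real.exp_pos _) (by positivity)]
      refine le_trans (le_of_eq ?_) this
      field_simp
    refine h4.trans (h5.trans ?_)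
    have h6 : 1 / y ≤ 4 * ‖w - z‖ / d := by
      rw [hy, one_div_div, div_le_div_iff_of_pos_right hd]
      linarith
    gcongr

/-! ### Sums of weights and the choice of coefficients. -/

section WeightedSum

variable {K : ℕ → Set ℂ} {a : ℕ → ℝ} {v : ℂ → ℝ}

theorem summable_mul_circleWeight (ha : ∀ k, 0 < a k) (hs : Summable a) {z : ℂ} (hz : z ∈ disk) :
    Summable fun k => a k * circleWeight (K k) z :=
  Summable.of_nonneg_of_le (fun k => (mul_pos (ha k) (circleWeight_pos _ _)).le)
    (fun k => mul_le_of_le_one_right (ha k).le (circleWeight_le_one _ hz)) hs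

theorem mul_circleWeight_le_of_hasSum (ha : ∀ k, 0 < a k)
    (hv : ∀ z ∈ disk, HasSum (fun k => a k * circleWeight (K k) z) (v z)) {z : ℂ} (hz : z ∈ disk)
    (k : ℕ) : a k * circleWeight (K k) z ≤ v z :=
  le_hasSum (hv z hz) k fun j _ => (mul_pos (ha j) (circleWeight_pos _ _)).le

theorem le_tsum_of_hasSum (ha : ∀ k, 0 < a k) (hs : Summable a)
    (hv : ∀ z ∈ disk, HasSum (fun k => a k * circleWeight (K k) z) (v z)) {z : ℂ} (hz : z ∈ disk) :
    v z ≤ ∑' k, a k :=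
  hasSum_le (fun k => mul_le_of_le_one_right (ha k).le (circleWeight_le_one _ hz)) (hv z hz)
    hs.hasSum

theorem pos_of_hasSum (ha : ∀ k, 0 < a k)
    (hv : ∀ z ∈ disk, HasSum (fun k => a k * circleWeight (K k) z) (v z)) {z : ℂ} (hz : z ∈ disk) :
    0 < v z :=
  (mul_pos (ha 0) (circleWeight_pos _ _)).trans_le (mul_circleWeight_le_of_hasSum ha hv hz 0)

theorem isAdmissibleWeight_of_hasSum (ha : ∀ k, 0 < a k) (hs : Summable a)
    (hv : ∀ z ∈ disk, HasSum (fun k => a k * circleWeight (K k) z) (v z)) :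
    IsAdmissibleWeight v := by
  refine ⟨?_, fun r hr hr1 => ?_, fun r hr hr1 => ?_⟩
  · refine Integrable.of_bound ?_ (∑' k, a k) ?_
    · refine aestronglyMeasurable_of_tendsto_ae Filter.atTop
        (f := fun m z => ∑ k ∈ Finset.range m, a k * circleWeight (K k) z) (fun m => ?_) ?_
      · exact (Finset.measurable_fun_sum _ fun k _ =>
          (measurable_circleWeight (K k)).const_mul (a k)).aestronglyMeasurable
      · filter_upwards [ae_diskArea_mem] with z hz using (hv z hz).tendsto_sum_nat
    · filter_upwards [ae_diskArea_mem] with z hz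
      rw [Real.norm_of_nonneg (pos_of_hasSum ha hv hz).le]
      exact le_tsum_of_hasSum ha hs hv hz
  · have hpos : 0 < a 0 * Real.exp (-(2 / (1 - r))) := mul_pos (ha 0) (Real.exp_pos _)
    -- Halving turns the weak lower bound into the strict one demanded of an admissible weight.
    refine ⟨a 0 * Real.exp (-(2 / (1 - r))) / 2, by positivity, ae_of_all _ fun z hz => ?_⟩
    rw [mem_ball_zero_iff] at hz
    have h1 := mul_circleWeight_le_of_hasSum ha hv (mem_ball_zero_iff.2 (hz.trans hr1)) 0
    have h2 := mul_le_mul_of_nonneg_left (le_circleWeight (K 0) hr1 hz.le) (ha 0).le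
    linarith
  · filter_upwards [ae_diskArea_mem] with z hz
    have hrz : (r * z : ℂ) ∈ disk := by
      rw [disk, mem_ball_zero_iff] at *
      rw [norm_mul, Complex.norm_real, Real.norm_of_nonneg hr.le]
      nlinarith [norm_nonneg z]
    exact hasSum_le (fun k => mul_le_mul_of_nonneg_left
      (circleWeight_le_comp_mul (K k) hz hr hr1) (ha k).le) (hv z hz) (hv _ hrz)

end WeightedSum

/-- Closed sets disjoint from compact ones stay at a positive distance. -/
theorem exists_pos_le_infEDist {D E : Set ℂ} (hD : IsCompact D) (hE : IsClosed E)
    (hDE : Disjoint D E) :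
    ∃ d : ℝ, 0 < d ∧ d ≤ 1 ∧ ∀ w ∈ D, ENNReal.ofReal d ≤ Metric.infEDist w E := by
  obtain ⟨δ, hδ, h⟩ := hDE.exists_thickenings hD hE
  refine ⟨min δ 1, by positivity, min_le_right _ _, fun w hw => ?_⟩
  refine le_trans (ENNReal.ofReal_le_ofReal (min_le_left _ _)) (not_lt.1 fun hlt => ?_)
  exact Set.disjoint_left.1 h (Metric.self_subset_thickening hδ D hw)
    (Metric.mem_thickening_iff_infEDist_lt.2 hlt)

/-- The choice of the coefficients: away from the union of the closed sets the weight decays to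
high order. -/
theorem exists_coefficients {K D : ℕ → Set ℂ} (hK : ∀ k, IsClosed (K k))
    (hD : ∀ k, IsCompact (D k)) (hmono : Monotone D) (hDs : ∀ k, D k ⊆ Metric.sphere 0 1)
    (hKD : ∀ j k, Disjoint (D j) (K k)) :
    ∃ a : ℕ → ℝ, (∀ k, 0 < a k) ∧ Summable a ∧ ∀ w ∈ ⋃ j, D j, ∃ C : ℝ, ∀ v : ℂ → ℝ,
      (∀ z ∈ disk, HasSum (fun k => a k * circleWeight (K k) z) (v z)) →
      ∀ z ∈ disk, v z ≤ C * ‖w - z‖ ^ 12 := by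
  choose d hd0 hd1 hd using fun k => exists_pos_le_infEDist (hD k) (hK k) (hKD k k)
  have hgeo : Summable fun k : ℕ => ((1 : ℝ) / 2) ^ k := summable_geometric_two
  -- The factor `d k ^ 12` cancels the `(4 / d k) ^ 12` of the decay estimate, and the geometric
  -- factor gives summability.
  refine ⟨fun k => (1 / 2) ^ k * d k ^ 12, fun k => by have := hd0 k; positivity,
    Summable.of_nonneg_of_le (fun k => by have := hd0 k; positivity)
      (fun k => mul_le_of_le_one_right (by positivity) (pow_le_one₀ (hd0 k).le (hd1 k))) hgeo,
    fun w hw => ?_⟩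
  obtain ⟨j, hj⟩ := Set.mem_iUnion.1 hw
  have hw1 : ‖w‖ = 1 := mem_sphere_zero_iff_norm.1 (hDs j hj)
  have hc : ∀ k, ∃ c : ℝ, (j ≤ k → c = (Nat.factorial 12 : ℝ) * 4 ^ 12 * (1 / 2) ^ k) ∧
      ∀ z ∈ disk, (1 / 2) ^ k * d k ^ 12 * circleWeight (K k) z ≤ c * ‖w - z‖ ^ 12 := by
    intro k
    -- For `k ≥ j` the point `w` lies in `D k`, so `d k` applies. The finitely many earlier sets use
    -- their own distance `e` to `w`; those constants do not affect summability.
    rcases le_or_gt j k with hjk | hjk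
    · refine ⟨_, fun _ => rfl, fun z hz => ?_⟩
      have h := circleWeight_le_of_le_infEDist hw1 hz (hd0 k) ((hd1 k).trans one_le_two)
        (hd k w (hmono hjk hj))
      have hdk := hd0 k
      calc (1 / 2) ^ k * d k ^ 12 * circleWeight (K k) z
          ≤ (1 / 2) ^ k * d k ^ 12 *
            ((Nat.factorial 12 : ℝ) * (4 / d k) ^ 12 * ‖w - z‖ ^ 12) := by gcongr
        _ = _ := by field_simp
    · obtain ⟨e, he0, he1, he⟩ := exists_pos_le_infEDist isCompact_singleton (hK k)
        ((hKD j k).mono_left (Set.singleton_subset_iff.2 hj))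
      refine ⟨(1 / 2) ^ k * d k ^ 12 * ((Nat.factorial 12 : ℝ) * (4 / e) ^ 12),
        fun h => absurd h hjk.not_ge, fun z hz => ?_⟩
      rw [mul_assoc ((1 / 2) ^ k * d k ^ 12)]
      have hdk := hd0 k
      gcongr
      exact circleWeight_le_of_le_infEDist hw1 hz he0 (he1.trans one_le_two) (he w rfl)
  choose c hc1 hc2 using hc
  have hcs : Summable c := by
    rw [← summable_nat_add_iff j]
    refine (((summable_nat_add_iff j).2 hgeo).mul_left
      ((Nat.factorial 12 : ℝ) * 4 ^ 12)).congr fun k => ?_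
    exact (hc1 _ (Nat.le_add_left _ _)).symm
  exact ⟨∑' k, c k, fun v hv z hz =>
    hasSum_le (fun k => hc2 k z hz) (hv z hz) (hcs.hasSum.mul_right _)⟩

/-! ### Boundary points that belong to the maximal domain. -/

namespace IsWeightedSpace

variable {H : Type*} [NormedAddCommGroup H] [InnerProductSpace ℂ H] {v : ℂ → ℝ}
  {ι : H →ₗ[ℂ] Hol disk}

/-- The integrand is the derivative of `P(t w) + (1 - t) w P'(t w)`. The factor `1 - t` offsets
growth of the second derivative at the boundary. -/
theorem _root_.Polynomial.eval_eq_taylor_integral (P : ℂ[X]) (w : ℂ) :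
    P.eval w = P.eval 0 + w * (derivative P).eval 0 +
      ∫ t in (0 : ℝ)..1, (1 - t : ℂ) * w ^ 2 * (derivative (derivative P)).eval (t * w) := by
  have hd : ∀ (Q : ℂ[X]) (t : ℝ),
      HasDerivAt (fun s : ℝ => Q.eval (s * w)) (w * (derivative Q).eval (t * w)) t := by
    intro Q t
    have h1 : HasDerivAt (fun s : ℝ => (s : ℂ) * w) w t := by
      simpa using (Complex.ofRealCLM.hasDerivAt (x := t)).mul_const w
    have h2 := (Q.hasDerivAt (t * w)).comp t h1
    rw [mul_comm]
    exact h2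
  have hg : ∀ t ∈ Set.uIcc (0 : ℝ) 1, HasDerivAt
      (fun s : ℝ => P.eval (s * w) + (1 - s : ℂ) * w * (derivative P).eval (s * w))
      ((1 - t : ℂ) * w ^ 2 * (derivative (derivative P)).eval (t * w)) t := by
    intro t _
    have h1 : HasDerivAt (fun s : ℝ => (1 - s : ℂ) * w) (-1 * w) t :=
      ((Complex.ofRealCLM.hasDerivAt (x := t)).const_sub 1).mul_const w
    refine ((hd P t).fun_add (h1.fun_mul (hd (derivative P) t))).congr_deriv ?_
    ring
  rw [intervalIntegral.integral_eq_sub_of_hasDerivAt hg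
    (Continuous.intervalIntegrable (by fun_prop) _ _)]
  simp

/-- Boundary points at which the weight is bounded below in a Stolz angle belong to the maximal
domain. -/
theorem mem_maximalDomain_of_stolz (hι : IsWeightedSpace v 2 ι) {w : ℂ} (hw : ‖w‖ = 1) {δ : ℝ}
    (hδ : 0 < δ) (hv : ∀ t : ℝ, 0 ≤ t → t < 1 → ∀ z ∈ Metric.ball (t * w : ℂ) ((1 - t) / 2),
      δ ≤ v z) : w ∈ maximalDomain ι := by
  refine mem_maximalDomain_of_bound (C := 6 / √δ) fun f P hf => ?_
  -- The ball of radius `(1 - t) / 2` produces the 2 in this bound. Each of the three terms of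
  -- Taylor's formula is then at most `2 / √δ * ‖f‖`, whence `C = 6 / √δ`.
  have hb : ∀ k ≤ 2, ∀ t : ℝ, 0 ≤ t → t < 1 →
      (1 - t) * ‖(derivative^[k] P).eval (t * w)‖ ≤ 2 / √δ * ‖f‖ := by
    intro k hk t ht0 ht
    have ht' : 0 < 1 - t := by linarith
    have hsub : Metric.ball (t * w : ℂ) ((1 - t) / 2) ⊆ disk := by
      refine Metric.ball_subset_ball' ?_
      rw [dist_zero_right, norm_mul, Complex.norm_real, Real.norm_of_nonneg ht0, hw]
      linarith
    have h1 := enorm_sq_le_of_weight_ge (c := (t * w : ℂ)) (by linarith : 0 < (1 - t) / 2) hδ hsub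
      ((ι f).2.1.iteratedDeriv_of_isOpen Metric.isOpen_ball k)
      (ae_of_all _ fun z hz => hv t ht0 ht z hz)
    have h2 : ∫⁻ z, ENNReal.ofReal (‖iteratedDeriv k (ι f : ℂ → ℂ) z‖ ^ 2 * v z) ∂diskArea ≤
        ENNReal.ofReal (‖f‖ ^ 2) := by
      rw [← hι.weightedNormSq_eq]
      exact Finset.single_le_sum (f := fun k =>
        ∫⁻ z, ENNReal.ofReal (‖iteratedDeriv k (ι f : ℂ → ℂ) z‖ ^ 2 * v z) ∂diskArea)
        (fun _ _ => zero_le) (Finset.mem_range.2 (by omega))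
    have h3 := h1.trans h2
    rw [← ofReal_norm, ← ENNReal.ofReal_pow (norm_nonneg _), ← ENNReal.ofReal_mul (by positivity),
      ENNReal.ofReal_le_ofReal_iff (by positivity), hf,
      iteratedDeriv_polyOn P k (hsub (Metric.mem_ball_self (by linarith)))] at h3
    have hsq : 0 < √δ := Real.sqrt_pos.2 hδ
    rw [div_mul_eq_mul_div, le_div_iff₀ hsq]
    refine le_of_sq_le_sq ?_ (by positivity)
    rw [mul_pow, Real.sq_sqrt hδ.le]
    nlinarith
  have h0 := hb 0 (by norm_num) 0 le_rfl zero_lt_one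
  have h1 := hb 1 (by norm_num) 0 le_rfl zero_lt_one
  simp only [Function.iterate_zero, id, Function.iterate_one, Complex.ofReal_zero, zero_mul,
    sub_zero, one_mul] at h0 h1
  have h2 : ‖∫ t in (0 : ℝ)..1, (1 - t : ℂ) * w ^ 2 *
      (derivative (derivative P)).eval (t * w)‖ ≤ 2 / √δ * ‖f‖ * |1 - 0| := by
    refine intervalIntegral.norm_integral_le_of_norm_le_const fun t ht => ?_
    rw [Set.uIoc_of_le zero_le_one] at ht
    rw [norm_mul, norm_mul, norm_pow, hw, one_pow, mul_one, ← Complex.ofReal_one,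
      ← Complex.ofReal_sub, Complex.norm_real, Real.norm_of_nonneg (by linarith [ht.2])]
    rcases ht.2.lt_or_eq with h | rfl
    · exact hb 2 le_rfl t ht.1.le h
    · rw [sub_self, zero_mul]; positivity
  rw [P.eval_eq_taylor_integral w]
  have h3 := norm_add₃_le (a := P.eval 0) (b := w * (derivative P).eval 0)
    (c := ∫ t in (0 : ℝ)..1, (1 - t : ℂ) * w ^ 2 * (derivative (derivative P)).eval (t * w))
  rw [norm_mul, hw, one_mul] at h3
  have h4 : 6 / √δ * ‖f‖ = 3 * (2 / √δ * ‖f‖) := by ring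
  simp only [sub_zero, abs_one, mul_one] at h2
  linarith

/-! ### Points excluded from the maximal domain. -/

/-- The exponent `m + 2` leaves at least the power `m` after two derivatives, each of which costs a
factor of at most `m + 2`. -/
theorem _root_.Polynomial.norm_eval_iterate_derivative_linear_pow_le {a b z : ℂ} (hb : ‖b‖ ≤ 1)
    (hz : ‖a + b * z‖ ≤ 1) (m : ℕ) {k : ℕ} (hk : k ≤ 2) :
    ‖(derivative^[k] ((C a + C b * X) ^ (m + 2))).eval z‖ ≤
      ((m : ℝ) + 2) ^ 2 * ‖a + b * z‖ ^ m := by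
  have hm : (0 : ℝ) ≤ m := m.cast_nonneg
  have hx := norm_nonneg (a + b * z)
  have hd : derivative (C a + C b * X) = C b := by simp
  have hp : ∀ i, ‖a + b * z‖ ^ (m + i) ≤ ‖a + b * z‖ ^ m := fun i =>
    pow_le_pow_of_le_one hx hz (Nat.le_add_right _ _)
  have h1 : derivative ((C a + C b * X) ^ (m + 2)) =
      C ((m + 2) * b) * (C a + C b * X) ^ (m + 1) := by
    rw [derivative_pow, hd, Nat.add_sub_assoc one_le_two]
    push_cast
    simp only [C_mul]
    ring
  have h2 : derivative (derivative ((C a + C b * X) ^ (m + 2))) =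
      C ((m + 2) * (m + 1) * b ^ 2) * (C a + C b * X) ^ m := by
    rw [h1, derivative_C_mul, derivative_pow, hd, Nat.add_sub_cancel]
    push_cast
    simp only [C_mul, C_pow]
    ring
  have hn : ∀ i : ℕ, ‖(m : ℂ) + i‖ = m + i := fun i => by
    rw [← Nat.cast_add, Complex.norm_natCast, Nat.cast_add]
  have hn1 : ‖(m : ℂ) + 1‖ = m + 1 := by simpa using hn 1
  have hn2 : ‖(m : ℂ) + 2‖ = m + 2 := by simpa using hn 2
  interval_cases k
  · simp only [Function.iterate_zero, id, eval_pow, eval_add, eval_C, eval_mul, eval_X, norm_pow]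
    exact (hp 2).trans (le_mul_of_one_le_left (by positivity) (by nlinarith))
  · rw [Function.iterate_one, h1]
    simp only [eval_pow, eval_add, eval_C, eval_mul, eval_X, norm_pow, norm_mul, hn2]
    gcongr ?_ * ?_
    · nlinarith [norm_nonneg b]
    · exact hp 1
  · rw [Function.iterate_succ_apply', Function.iterate_one, h2]
    simp only [eval_pow, eval_add, eval_C, eval_mul, eval_X, norm_pow, norm_mul, hn2, hn1]
    gcongr ?_ * _
    calc ((m : ℝ) + 2) * (m + 1) * ‖b‖ ^ 2 ≤ (m + 2) * (m + 2) * 1 ^ 2 := by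
          gcongr
          norm_num
      _ = _ := by ring

open Filter Topology in
/-- Points at which powers of a linear function give functions of norm tending to zero do not
belong to the maximal domain. -/
theorem notMem_maximalDomain (hv : IsAdmissibleWeight v) (hι : IsWeightedSpace v 2 ι)
    (hv0 : ∀ z ∈ disk, 0 ≤ v z) {a b w : ℂ} (hw : a + b * w = 1) (hb : ‖b‖ ≤ 1)
    (hle : ∀ z ∈ disk, ‖a + b * z‖ ≤ 1) {e : ℕ → ℝ}
    (he : ∀ m, ∀ z ∈ disk, ‖a + b * z‖ ^ (2 * m) * v z ≤ e m)
    (hlim : Tendsto (fun m : ℕ => ((m : ℝ) + 2) ^ 4 * e m) atTop (𝓝 0)) :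
    w ∉ maximalDomain ι := by
  rintro ⟨L, hL⟩
  choose f hf using fun m : ℕ => hι.exists_polyOn hv ((C a + C b * X) ^ (m + 2))
  have hLf : ∀ m, L (f m) = 1 := fun m => by
    rw [hL (f m) _ (hf m)]
    simp [hw]
  have he0 : ∀ m, 0 ≤ e m := fun m =>
    (mul_nonneg (by positivity) (hv0 0 (Metric.mem_ball_self one_pos))).trans
      (he m 0 (Metric.mem_ball_self one_pos))
  have hbound : ∀ m, ‖f m‖ ^ 2 ≤
      3 * (diskArea Set.univ).toReal * (((m : ℝ) + 2) ^ 4 * e m) := fun m => by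
    have h := weightedNormSq_le_of_norm_sq_mul_le (v := v) (n := 2) (F := ι (f m))
      (B := ((m : ℝ) + 2) ^ 4 * e m) fun k hk z hz => by
        rw [hf, iteratedDeriv_polyOn _ k hz]
        have h1 := norm_eval_iterate_derivative_linear_pow_le hb (hle z hz) m hk
        calc _ ≤ (((m : ℝ) + 2) ^ 2 * ‖a + b * z‖ ^ m) ^ 2 * v z := by
              gcongr
              exact hv0 z hz
          _ = ((m : ℝ) + 2) ^ 4 * (‖a + b * z‖ ^ (2 * m) * v z) := by ring
          _ ≤ _ := by gcongr; exact he m z hz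
    have := he0 m
    rw [hι.weightedNormSq_eq, ← ENNReal.ofReal_toReal (measure_ne_top diskArea Set.univ),
      ← ENNReal.ofReal_mul (by positivity), ← ENNReal.ofReal_natCast, ← ENNReal.ofReal_one,
      ← ENNReal.ofReal_add (by positivity) zero_le_one, ← ENNReal.ofReal_mul (by positivity),
      ENNReal.ofReal_le_ofReal_iff (by positivity)] at h
    refine h.trans (le_of_eq ?_)
    push_cast
    ring
  have hsq : Tendsto (fun m => ‖f m‖ ^ 2) atTop (𝓝 0) := by
    refine squeeze_zero (fun m => by positivity) hbound ?_
    simpa using hlim.const_mul (3 * (diskArea Set.univ).toReal)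
  have hf0 : Tendsto f atTop (𝓝 0) := by
    rw [tendsto_zero_iff_norm_tendsto_zero]
    simpa [Function.comp_def, Real.sqrt_sq] using (Real.continuous_sqrt.tendsto 0).comp hsq
  have h1 := (L.continuous.tendsto 0).comp hf0
  rw [map_zero] at h1
  exact zero_ne_one (tendsto_nhds_unique (h1.congr hLf) tendsto_const_nhds)

end IsWeightedSpace

namespace IsWeightedSpace

variable {H : Type*} [NormedAddCommGroup H] [InnerProductSpace ℂ H] {v : ℂ → ℝ}
  {ι : H →ₗ[ℂ] Hol disk}

open Filter Topology in
-- The powers of `z / w` decay geometrically on the disk, which beats the factor `(m + 2) ^ 4`.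
theorem notMem_maximalDomain_of_one_lt_norm (hv : IsAdmissibleWeight v)
    (hι : IsWeightedSpace v 2 ι) (hv0 : ∀ z ∈ disk, 0 ≤ v z) {B : ℝ} (hB : ∀ z ∈ disk, v z ≤ B)
    {w : ℂ} (hw : 1 < ‖w‖) : w ∉ maximalDomain ι := by
  have hw0 : w ≠ 0 := norm_pos_iff.1 (zero_lt_one.trans hw)
  have hq : ‖w⁻¹‖ < 1 := by rw [norm_inv]; exact inv_lt_one_of_one_lt₀ hw
  have hle : ∀ z ∈ disk, ‖0 + w⁻¹ * z‖ ≤ ‖w⁻¹‖ := fun z hz => by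
    rw [zero_add, norm_mul]
    exact mul_le_of_le_one_right (norm_nonneg _) (mem_ball_zero_iff.1 hz).le
  refine hι.notMem_maximalDomain hv hv0 (a := 0) (b := w⁻¹) (by simp [hw0]) hq.le
    (fun z hz => (hle z hz).trans hq.le) (e := fun m => ‖w⁻¹‖ ^ (2 * m) * B)
    (fun m z hz => ?_) ?_
  · have := hv0 z hz
    have := hle z hz
    gcongr
    exact hB z hz
  · set q := ‖w⁻¹‖ ^ 2 with hq_def
    have hq0 : 0 < q := pow_pos (norm_pos_iff.2 (inv_ne_zero hw0)) 2
    have hq1 : |q| < 1 := by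
      rw [abs_of_pos hq0]
      exact pow_lt_one₀ (norm_nonneg _) hq two_ne_zero
    have h := ((tendsto_add_atTop_iff_nat 2).2
      (tendsto_pow_const_mul_const_pow_of_abs_lt_one 4 hq1)).mul_const (B / q ^ 2)
    rw [zero_mul] at h
    refine h.congr fun m => ?_
    rw [pow_mul, ← hq_def]
    push_cast
    field_simp
    ring

/-- Combine `1 - x ≤ exp (-x)` with the bound of `x ^ 6` by a multiple of `exp ((m + 1) * x)`; using
`m + 1` covers `m = 0` at the cost of a factor `exp x ≤ exp 1`. -/
theorem _root_.pow_six_mul_one_sub_pow_le {x : ℝ} (hx0 : 0 ≤ x) (hx1 : x ≤ 1) (m : ℕ) :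
    (1 - x) ^ m * x ^ 6 ≤ Real.exp 1 * Nat.factorial 6 / ((m : ℝ) + 1) ^ 6 := by
  have hm : (0 : ℝ) < m + 1 := by positivity
  have h1 : (1 - x) ^ m ≤ Real.exp (-x) ^ m := by
    gcongr
    exact Real.one_sub_le_exp_neg x
  have h2 : Real.exp (-x) ^ m * Real.exp ((m + 1) * x) = Real.exp x := by
    rw [← Real.exp_nat_mul, ← Real.exp_add]
    congr 1; ring
  have h3 := Real.pow_div_factorial_le_exp ((m + 1) * x) (by positivity) 6
  have h4 : x ^ 6 ≤ Nat.factorial 6 / ((m : ℝ) + 1) ^ 6 * Real.exp ((m + 1) * x) := by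
    rw [div_le_iff₀ (by positivity), mul_pow] at h3
    rw [div_mul_eq_mul_div, le_div_iff₀ (by positivity)]
    linarith
  calc (1 - x) ^ m * x ^ 6
      ≤ Real.exp (-x) ^ m * (Nat.factorial 6 / ((m : ℝ) + 1) ^ 6 * Real.exp ((m + 1) * x)) := by
        gcongr
    _ = Real.exp x * (Nat.factorial 6 / ((m : ℝ) + 1) ^ 6) := by rw [← h2]; ring
    _ ≤ Real.exp 1 * (Nat.factorial 6 / ((m : ℝ) + 1) ^ 6) := by gcongr
    _ = _ := by ring

open Filter Topology ComplexConjugate in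
-- The function `(1 + conj w * z) / 2` peaks at `w`: by the parallelogram law its squared modulus on
-- the disk is at most `1 - x` with `x = ‖w - z‖ ^ 2 / 4`. The weight is `O(x ^ 6)`, so the product
-- with the `m`-th power is `O((m + 1) ^ (-6))`.
theorem notMem_maximalDomain_of_decay (hv : IsAdmissibleWeight v)
    (hι : IsWeightedSpace v 2 ι) (hv0 : ∀ z ∈ disk, 0 ≤ v z) {w : ℂ} (hw : ‖w‖ = 1) {B : ℝ}
    (hB : ∀ z ∈ disk, v z ≤ B * ‖w - z‖ ^ 12) : w ∉ maximalDomain ι := by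
  have hww : conj w * w = 1 := by
    rw [mul_comm, Complex.mul_conj, Complex.normSq_eq_norm_sq, hw]; simp
  have hid : ∀ z : ℂ, ‖(1 / 2 : ℂ) + conj w / 2 * z‖ ^ 2 = (1 + ‖z‖ ^ 2) / 2 - ‖w - z‖ ^ 2 / 4 := by
    intro z
    have h1 : (1 / 2 : ℂ) + conj w / 2 * z = conj w * ((w + z) / 2) := by
      rw [mul_div_assoc', mul_add, hww]; ring
    have h2 := parallelogram_law_with_norm ℝ w z
    rw [h1, norm_mul, RCLike.norm_conj, hw, one_mul, norm_div, Complex.norm_ofNat]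
    rw [hw] at h2
    nlinarith
  have hx : ∀ z ∈ disk, ‖(1 / 2 : ℂ) + conj w / 2 * z‖ ^ 2 ≤ 1 - ‖w - z‖ ^ 2 / 4 := fun z hz => by
    have h1 : ‖z‖ ≤ 1 := (mem_ball_zero_iff.1 hz).le
    rw [hid]
    nlinarith [norm_nonneg z]
  have hB0 : 0 ≤ B := by
    have := (hv0 0 (Metric.mem_ball_self one_pos)).trans (hB 0 (Metric.mem_ball_self one_pos))
    simpa [hw] using this
  set A : ℝ := B * 4 ^ 6 * (Real.exp 1 * Nat.factorial 6) with hA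
  refine hι.notMem_maximalDomain hv hv0 (a := 1 / 2) (b := conj w / 2) ?_ ?_ (fun z hz => ?_)
    (e := fun m => A / ((m : ℝ) + 1) ^ 6) (fun m z hz => ?_) ?_
  · rw [div_mul_eq_mul_div, hww]; norm_num
  · rw [norm_div, RCLike.norm_conj, hw]; norm_num
  · have := hx z hz
    exact (sq_le_one_iff₀ (norm_nonneg _)).1 (this.trans (by linarith [sq_nonneg ‖w - z‖]))
  · have hx1 : ‖w - z‖ ^ 2 / 4 ≤ 1 := by linarith [hx z hz, sq_nonneg ‖(1 / 2 : ℂ) + conj w / 2 * z‖]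
    have h1 := pow_six_mul_one_sub_pow_le (x := ‖w - z‖ ^ 2 / 4) (by positivity) hx1 m
    calc ‖(1 / 2 : ℂ) + conj w / 2 * z‖ ^ (2 * m) * v z
        ≤ (1 - ‖w - z‖ ^ 2 / 4) ^ m * (B * ‖w - z‖ ^ 12) := by
          rw [pow_mul]
          have := hv0 z hz
          have := hx z hz
          gcongr
          exact hB z hz
      _ = B * 4 ^ 6 * ((1 - ‖w - z‖ ^ 2 / 4) ^ m * (‖w - z‖ ^ 2 / 4) ^ 6) := by ring
      _ ≤ B * 4 ^ 6 * (Real.exp 1 * Nat.factorial 6 / ((m : ℝ) + 1) ^ 6) := by gcongr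
      _ = A / ((m : ℝ) + 1) ^ 6 := by rw [hA]; ring
  · have hA0 : 0 ≤ A := by positivity
    refine squeeze_zero (g := fun m : ℕ => 16 * A * (1 / ((m : ℝ) + 1))) (fun m => by positivity)
      (fun m => ?_) ?_
    · have hm : (0 : ℝ) ≤ m := m.cast_nonneg
      have h2 : ((m : ℝ) + 2) ^ 4 ≤ (2 * (m + 1)) ^ 4 := by gcongr; linarith
      calc ((m : ℝ) + 2) ^ 4 * (A / ((m : ℝ) + 1) ^ 6)
          ≤ (2 * (m + 1)) ^ 4 * (A / ((m : ℝ) + 1) ^ 6) := by gcongr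
        _ = 16 * A * (1 / ((m : ℝ) + 1) ^ 2) := by field_simp; ring
        _ ≤ 16 * A * (1 / ((m : ℝ) + 1)) := by
            gcongr
            nlinarith
    · simpa using tendsto_one_div_add_atTop_nhds_zero_nat.const_mul (16 * A)

end IsWeightedSpace

/-! ### Assembly of the theorem. -/

theorem theorem4p5 (Γ : Set ℂ) (hΓ : Γ ⊆ Metric.sphere (0 : ℂ) 1)
    (hF : IsFSigma Γ) (hG : IsGδ Γ) :
    ∃ (K : ℕ → Set ℂ) (a : ℕ → ℝ) (v : ℂ → ℝ),
      (∀ k, IsClosed (K k)) ∧ (⋃ k, K k) = Γ ∧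
      (∀ k, 0 < a k) ∧ Summable a ∧
      (∀ z ∈ disk, HasSum (fun k => a k * circleWeight (K k) z) (v z)) ∧
      IsAdmissibleWeight v ∧
      ∃ (H : Type) (_ : NormedAddCommGroup H) (_ : InnerProductSpace ℂ H)
        (_ : CompleteSpace H) (ι : H →ₗ[ℂ] Hol disk),
        IsWeightedSpace v 2 ι ∧
        PolynomialsDense ι ∧ EvaluationsContinuous ι ∧ ShiftContinuous ι ∧
        maximalDomain ι = disk ∪ Γ := by
  obtain ⟨K, hK, hKΓ⟩ := hF
  obtain ⟨U, hU, hUΓ⟩ := hG.eq_iInter_nat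
  -- The Gδ property enters here: the complements of the open sets `U i` exhaust the complement of
  -- `Γ`, and finite unions make the exhaustion increasing.
  set D : ℕ → Set ℂ := fun j => Metric.sphere 0 1 ∩ ⋃ i ∈ Finset.range (j + 1), (U i)ᶜ with hD
  have hDc : ∀ j, IsCompact (D j) := fun j => (isCompact_sphere 0 1).inter_right
    (isClosed_biUnion_finset fun i _ => (hU i).isClosed_compl)
  have hDm : Monotone D := fun i j hij => Set.inter_subset_inter_right _
    (Set.biUnion_subset_biUnion_left fun l hl => by
      simp only [SetLike.mem_coe, Finset.mem_range] at *; omega)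
  have hDΓ : ∀ j, Disjoint (D j) Γ := fun j => Set.disjoint_left.2 fun w hw hwΓ => by
    obtain ⟨i, -, hi⟩ := Set.mem_iUnion₂.1 hw.2
    exact hi (Set.mem_iInter.1 (hUΓ ▸ hwΓ) i)
  have hDU : ∀ w ∈ Metric.sphere (0 : ℂ) 1, w ∉ Γ → w ∈ ⋃ j, D j := fun w hw hwΓ => by
    rw [hUΓ, Set.mem_iInter, not_forall] at hwΓ
    obtain ⟨i, hi⟩ := hwΓ
    exact Set.mem_iUnion.2 ⟨i, hw, Set.mem_iUnion₂.2 ⟨i, by simp, hi⟩⟩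
  obtain ⟨a, ha, has, hdecay⟩ := exists_coefficients hK hDc hDm (fun j => Set.inter_subset_left)
    fun j k => (hDΓ j).mono_right (hKΓ ▸ Set.subset_iUnion K k)
  set v : ℂ → ℝ := fun z => ∑' k, a k * circleWeight (K k) z
  have hsum : ∀ z ∈ disk, HasSum (fun k => a k * circleWeight (K k) z) (v z) := fun z hz =>
    (summable_mul_circleWeight ha has hz).hasSum
  have hv := isAdmissibleWeight_of_hasSum ha has hsum
  have hv0 : ∀ z ∈ disk, 0 ≤ v z := fun z hz => (pos_of_hasSum ha hsum hz).le
  obtain ⟨H, i1, i2, i3, ι, hι⟩ := exists_isWeightedSpace hv 2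
  refine ⟨K, a, v, hK, hKΓ, ha, has, hsum, hv, H, i1, i2, i3, ι, hι, hι.polynomialsDense hv,
    hι.evaluationsContinuous hv, hι.shiftContinuous hv, Set.Subset.antisymm (fun w hw => ?_)
    (Set.union_subset (hι.disk_subset_maximalDomain hv) fun w hw => ?_)⟩
  · rcases lt_trichotomy ‖w‖ 1 with h | h | h
    · exact Or.inl (mem_ball_zero_iff.2 h)
    · by_contra hn
      obtain ⟨B, hB⟩ := hdecay w (hDU w (mem_sphere_zero_iff_norm.2 h) fun hwΓ => hn (Or.inr hwΓ))
      exact hι.notMem_maximalDomain_of_decay hv hv0 h (hB v hsum) hw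
    · exact absurd hw (hι.notMem_maximalDomain_of_one_lt_norm hv hv0
        (fun z hz => le_tsum_of_hasSum ha has hsum hz) h)
  · have hw1 : ‖w‖ = 1 := mem_sphere_zero_iff_norm.1 (hΓ hw)
    obtain ⟨k, hk⟩ := Set.mem_iUnion.1 (hKΓ.symm ▸ hw)
    refine hι.mem_maximalDomain_of_stolz hw1 (mul_pos (ha k) (Real.exp_pos (-4)))
      fun t ht0 ht z hz => ?_
    have hzd : z ∈ disk := by
      have : Metric.ball (t * w : ℂ) ((1 - t) / 2) ⊆ disk := by
        refine Metric.ball_subset_ball' ?_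
        rw [dist_zero_right, norm_mul, Complex.norm_real, Real.norm_of_nonneg ht0, hw1]
        linarith
      exact this hz
    exact (mul_le_mul_of_nonneg_left (exp_neg_four_le_circleWeight hk hw1 ht0 ht hz)
      (ha k).le).trans (mul_circleWeight_le_of_hasSum ha hsum hzd k)
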